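/- Let $n\ge 2$, let $\varepsilon>0$, and let $f,g\in\mathbb C[z_1,\dots,z_n]$ be weighted homogeneous polynomials with weights $w_f$ and $w_g$ such that $w_g=s\,w_f$ for a positive rational number $s$. (A polynomial $h$ is weighted homogeneous with weights $w=(w_1,\dots,w_n)$, where the $w_j$ are positive rational numbers, if $\sum_{j=1}^n \frac{z_j}{w_j}\frac{\partial h}{\partial z_j}=h$.) Let $S_\varepsilon=\{z\in\mathbb C^n : \|z\|=\varepsilon\}$, $K_{fg}=\{z\in S_\varepsilon : f(z)g(z)=0\}$, and let $$\Phi:S_\varepsilon\setminus K_{fg}\to T^2=S^1\times S^1,\qquad \Phi(z)=\left(\frac{f(z)}{|f(z)|},\frac{g(z)}{|g(z)|}\right).$$ Let $p\in S_\varepsilon\setminus K_{fg}$ be a singular point of $\Phi$, i.e. $\operatorname{rank} d\Phi_p<2$. Near $p$ let $\log f$ and $\log g$ be any holomorphic branches of the logarithms of $f$ and $g$. Write $\langle u,v\rangle=\sum_j u_j\overline{v_j}$, $\operatorname{grad} h=\left(\overline{\partial h/\partial z_1},\dots,\overline{\partial h/\partial z_n}\right)$ and $\operatorname{Hess}_p(h)=\left(\frac{\partial^2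 h}{\partial z_j\partial z_k}(p)\right)_{j,k}$ for a holomorphic function $h$. Then the real vector space $$\{v\in\mathbb C^n : \operatorname{Re}\langle v,p\rangle=\operatorname{Re}\langle v,i\operatorname{grad}\log f(p)\rangle=0\}$$ has dimension $2n-2$, and for every real basis $r_1,\dots,r_{2n-2}$ of it, with $V$ the complex $n\times(2n-2)$ matrix whose columns are $r_1,\dots,r_{2n-2}$, the point $p$ is a fold point of $\Phi$ if and only if $$\det\operatorname{Re}\left(V^T\operatorname{Hess}_p\bigl(-i(\log g-s\log f)\bigr)V\right)\neq 0 .$$ Here $p$ is a fold point of $\Phi$ if there are $C^\infty$ local coordinates centred at $p$ and at $\Phi(p)$ in which $\Phi$ has the form $(x_0,x_1,\dots,x_{2n-2})\mapsto(x_0,\pm x_1^2\pm\dots\pm x_{2n-2}^2)$. -/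

import Mathlib

open scoped Manifold ContDiff Topology ComplexConjugate

/-! ### Singular points and fold points of maps between manifolds -/

section SingularityTheory

variable {E H E' H' : Type*}
  [NormedAddCommGroup E] [NormedSpace ℝ E] [TopologicalSpace H]
  [NormedAddCommGroup E'] [NormedSpace ℝ E'] [TopologicalSpace H']
  (I : ModelWithCorners ℝ E H) (J : ModelWithCorners ℝ E' H')
  {M N : Type*} [TopologicalSpace M] [ChartedSpace H M]
  [TopologicalSpace N] [ChartedSpace H' N]

/-- `p` is a singular point of the smooth map `F : M → N` when the rank of the differential
`dF_p : T_p M → T_{F p} N` is smaller than `min (dim M) (dim N)`. -/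
def IsSingularPoint (F : M → N) (p : M) : Prop :=
  Module.finrank ℝ (mfderiv I J F p).toLinearMap.range <
    min (Module.finrank ℝ E) (Module.finrank ℝ E')

/-- `p` is a fold point of the map `F : M → N` into a surface `N` when there are smooth local
coordinates `x = (x₀, x₁, …, x_k)` of `M` centred at `p` and `y = (y₀, y₁)` of `N` centred at
`F p` in which `F` has the form `(x₀, x₁, …, x_k) ↦ (x₀, ± x₁² ± ⋯ ± x_k²)`, with `1 ≤ k`.
Here `x₀` is the first component of `x` and `(x₁, …, x_k)` its second component. -/
def IsFoldPoint (F : M → N) (p : M) : Prop :=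
  ∃ (k : ℕ) (x : PartialDiffeomorph I 𝓘(ℝ, ℝ × (Fin k → ℝ)) M (ℝ × (Fin k → ℝ)) ∞)
    (y : PartialDiffeomorph J 𝓘(ℝ, ℝ × ℝ) N (ℝ × ℝ) ∞) (σ : Fin k → ℝ),
    1 ≤ k ∧ (∀ i, σ i = 1 ∨ σ i = -1) ∧
    p ∈ x.source ∧ F p ∈ y.source ∧ x p = 0 ∧ y (F p) = 0 ∧
    ∀ q ∈ x.source, F q ∈ y.source ∧
      y (F q) = ((x q).1, ∑ i, σ i * (x q).2 i ^ 2)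

end SingularityTheory

/-! ### Complex calculus on `ℂⁿ` -/

/-- `ℂⁿ` with its Hermitian norm. -/
abbrev Cn (n : ℕ) : Type := EuclideanSpace ℂ (Fin n)

/-- The polynomial function `ℂⁿ → ℂ` of a polynomial. -/
noncomputable def polyFun {n : ℕ} (f : MvPolynomial (Fin n) ℂ) (z : Cn n) : ℂ :=
  MvPolynomial.eval (fun j => z j) f

/-- The holomorphic partial derivative `∂h/∂z_j` at `z`. -/
noncomputable def partialZ {n : ℕ} (h : Cn n → ℂ) (j : Fin n) (z : Cn n) : ℂ :=
  fderiv ℂ h z (EuclideanSpace.single j 1)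

/-- The gradient `grad h = (conj (∂h/∂z_1), …, conj (∂h/∂z_n))` of a holomorphic function, so that
`dh_z(v) = ⟨v, grad h (z)⟩` for the Hermitian product `⟨u, v⟩ = ∑ u_j conj (v_j)`. -/
noncomputable def complexGrad {n : ℕ} (h : Cn n → ℂ) (z : Cn n) : Cn n :=
  WithLp.toLp 2 fun j => conj (partialZ h j z)

/-- The complex Hessian matrix `(∂²h/∂z_j∂z_k (p))` of a holomorphic function. -/
noncomputable def complexHess {n : ℕ} (h : Cn n → ℂ) (p : Cn n) : Matrix (Fin n) (Fin n) ℂ :=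
  Matrix.of fun j k => partialZ (partialZ h k) j p

/-- `L` is a holomorphic branch of `log f` near `p`. -/
def IsLogBranchAt {n : ℕ} (f : MvPolynomial (Fin n) ℂ) (L : Cn n → ℂ) (p : Cn n) : Prop :=
  AnalyticAt ℂ L p ∧ ∀ᶠ z in 𝓝 p, Complex.exp (L z) = polyFun f z

/-- `f` is a weighted homogeneous polynomial with weights `w`: the weights are positive rational
numbers and `∑ (z_j / w_j) ∂f/∂z_j = f`. -/
def HasWeights {n : ℕ} (f : MvPolynomial (Fin n) ℂ) (w : Fin n → ℚ) : Prop :=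
  (∀ j, 0 < w j) ∧
    ∑ j, MvPolynomial.C ((w j : ℂ)⁻¹) * MvPolynomial.X j * MvPolynomial.pderiv j f = f

/-- The real vector space of all `v ∈ ℂⁿ` with `Re ⟨v, a⟩ = Re ⟨v, b⟩ = 0`, where
`⟨u, v⟩ = ∑ u_j conj (v_j)` is written `inner ℂ v u` in Mathlib. -/
def realOrthogonal {n : ℕ} (a b : Cn n) : Submodule ℝ (Cn n) where
  carrier := {v | (inner ℂ a v).re = 0 ∧ (inner ℂ b v).re = 0}
  zero_mem' := by simp
  add_mem' := by
    rintro u v ⟨h1, h2⟩ ⟨h3, h4⟩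
    simp [h1, h2, h3, h4]
  smul_mem' := by
    rintro c v ⟨h1, h2⟩
    simp [h1, h2]

/-! ### The sphere `S_ε ⊂ ℂⁿ` as a smooth manifold -/

instance factFinrankCn {n : ℕ} [hn : n.AtLeastTwo] :
    Fact (Module.finrank ℝ (Cn n) = (2 * n - 1) + 1) := ⟨by
  have h2 : 2 ≤ n := hn.prop
  have h := Module.finrank_mul_finrank ℝ ℂ (Cn n)
  rw [Complex.finrank_real_complex, finrank_euclideanSpace_fin] at h
  omega⟩

/-- The sphere `S_ε = {z ∈ ℂⁿ | ‖z‖ = ε}`. -/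
def CSphere (n : ℕ) (ε : ℝ) : Type := Metric.sphere (0 : Cn n) ε

namespace CSphere

instance (n : ℕ) (ε : ℝ) : TopologicalSpace (CSphere n ε) :=
  inferInstanceAs (TopologicalSpace (Metric.sphere (0 : Cn n) ε))

/-- The inclusion of `S_ε` in `ℂⁿ`. -/
def val {n : ℕ} {ε : ℝ} (z : CSphere n ε) : Cn n := Subtype.val z

theorem continuous_val {n : ℕ} {ε : ℝ} : Continuous (val : CSphere n ε → Cn n) :=
  continuous_subtype_val

/-- The homeomorphism `z ↦ z / ε` from `S_ε` onto the unit sphere. -/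
noncomputable def toUnit (n : ℕ) (ε : ℝ) [hε : Fact (0 < ε)] :
    CSphere n ε ≃ₜ Metric.sphere (0 : Cn n) 1 where
  toFun z := ⟨ε⁻¹ • z.val, by
    have h : ‖z.val‖ = ε := by simpa using (show z.val ∈ Metric.sphere (0 : Cn n) ε from z.2)
    have := hε.out
    simp [norm_smul, h, abs_of_pos this, this.ne']⟩
  invFun u := ⟨ε • u.1, by
    have h : ‖u.1‖ = 1 := by simp
    simp [norm_smul, abs_of_pos hε.out]⟩
  left_inv z := Subtype.ext (by simp [val, smul_smul, hε.out.ne'])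
  right_inv u := Subtype.ext (by simp [val, smul_smul, hε.out.ne'])
  continuous_toFun := (continuous_val.const_smul ε⁻¹).subtype_mk _
  continuous_invFun := (continuous_subtype_val.const_smul ε).subtype_mk _

/-- The smooth structure of `S_ε`: the one of Mathlib's unit sphere, carried over by the dilation
`z ↦ z / ε`. -/
noncomputable instance (n : ℕ) [n.AtLeastTwo] (ε : ℝ) [Fact (0 < ε)] :
    ChartedSpace (EuclideanSpace ℝ (Fin (2 * n - 1))) (CSphere n ε) where
  atlas := (fun e => (toUnit n ε).toOpenPartialHomeomorph.trans e) ''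
    atlas (EuclideanSpace ℝ (Fin (2 * n - 1))) (Metric.sphere (0 : Cn n) 1)
  chartAt z := (toUnit n ε).toOpenPartialHomeomorph.trans (chartAt _ (toUnit n ε z))
  mem_chart_source z := by simp
  chart_mem_atlas z := ⟨_, chart_mem_atlas _ _, rfl⟩

instance (n : ℕ) [n.AtLeastTwo] (ε : ℝ) [Fact (0 < ε)] :
    IsManifold (𝓡 (2 * n - 1)) ω (CSphere n ε) where
  compatible := by
    rintro _ _ ⟨e, he, rfl⟩ ⟨e', he', rfl⟩
    have h := HasGroupoid.compatible (G := contDiffGroupoid ω (𝓡 (2 * n - 1))) he he'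
    have key : (((toUnit n ε).toOpenPartialHomeomorph.trans e).symm.trans
        ((toUnit n ε).toOpenPartialHomeomorph.trans e')) = e.symm.trans e' := by
      apply OpenPartialHomeomorph.ext
      · intro x; simp
      · intro x; simp
      · ext x; simp
    simpa only [key] using h

end CSphere

/-! ### Milnor fibration product maps -/

/-- `S_ε ∖ K_{fg}`, where `K_{fg} = {z ∈ S_ε | f(z) g(z) = 0}`, as an open subset of `S_ε`. -/
def linkComplement {n : ℕ} (f g : MvPolynomial (Fin n) ℂ) (ε : ℝ) :
    TopologicalSpace.Opens (CSphere n ε) where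
  carrier := {z | polyFun f z.val * polyFun g z.val ≠ 0}
  is_open' := by
    have hc : ∀ h : MvPolynomial (Fin n) ℂ, Continuous fun z : CSphere n ε => polyFun h z.val :=
      fun h => (MvPolynomial.continuous_eval h).comp
        (continuous_pi fun j =>
          (EuclideanSpace.proj (𝕜 := ℂ) j).continuous.comp CSphere.continuous_val)
    exact isOpen_ne_fun ((hc f).mul (hc g)) continuous_const

/-- The point `c / |c|` of the unit circle, for `c ≠ 0`. -/
noncomputable def unitPhase (c : ℂ) (hc : c ≠ 0) : Circle :=
  ⟨c / (‖c‖ : ℂ), by simp [Submonoid.unitSphere, hc]⟩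

/-- The Milnor fibration product map `Φ = (f/|f|, g/|g|) : S_ε ∖ K_{fg} → T² = S¹ × S¹`. -/
noncomputable def milnorProductMap {n : ℕ} (f g : MvPolynomial (Fin n) ℂ) (ε : ℝ)
    (z : linkComplement f g ε) : Circle × Circle :=
  (unitPhase (polyFun f z.1.val) (left_ne_zero_of_mul z.2),
    unitPhase (polyFun g z.1.val) (right_ne_zero_of_mul z.2))

/-!
The weights make `f` and `g` eigenfunctions of the holomorphic flow
`c • z = (exp (c / w₁) z₁, …, exp (c / wₙ) zₙ)` with `w = w_f`: `log f` grows by `c` and `log g` by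
`s c`, so that `G = log g - s log f` is invariant (`HasWeights.polyFun_weightedFlow`,
`IsLogBranchAt.apply_weightedFlow`). After a shear of the angles of the torus, the map `Φ` is
`(Im log f, Im G)` (`exists_milnorProductMap_coordinates`).

Let `E` be the generator of the flow at `p`. The vector `i E` is tangent to the sphere, moves
`Im log f` at speed one and leaves `Im G` fixed. At a singular point `Im dG` therefore vanishes on
the tangent space of the sphere, and it vanishes on `E`, which is transverse to the sphere; hence
`dG = 0` at `p` (`fderiv_eq_zero_of_isSingularPoint`).

The flow moves the affine slice `p + W`, where `W` is the space of the theorem, over a neighbourhood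
of `p`. As `G` is invariant, it depends only on the position `u ∈ W` in the slice, and on the
sphere `(Im log f, u)` are local coordinates (`exists_slice_coordinates`). In them `Φ` is
`(t, u) ↦ (t, Q u)` with `Q u = Im G (p + u) - Im G p`, a function with critical point `0` and
Hessian `Re (Vᵀ Hess (-i G) V)`.

Such a map has a fold at `0` if and only if the Hessian of `Q` is nondegenerate. If it is, the
Morse lemma (`AnalyticAt.morse_lemma`) and Sylvester's law of inertia give the normal form
(`isFoldPoint_of_nondegenerate`). Conversely, comparing the terms of second order in both
coordinate systems along the slice `t = 0` shows that a multiple of the Hessian is isomorphic to a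
signed sum of squares (`nondegenerate_of_isFoldPoint`).
-/

/-! ### Hadamard's lemma and the Morse lemma for analytic functions -/

open Filter in
/-- Hadamard's lemma for analytic functions: a function vanishing at `0` factors as
`x ↦ A x x` with an analytic family `A` of linear maps. The power series of `A` is the shift of
the power series of `f`. -/
theorem AnalyticAt.exists_eventually_eq_apply {𝕜 E F : Type*} [NontriviallyNormedField 𝕜]
    [NormedAddCommGroup E] [NormedSpace 𝕜 E] [NormedAddCommGroup F] [NormedSpace 𝕜 F]
    [CompleteSpace F] {f : E → F} (hf : AnalyticAt 𝕜 f 0) (h0 : f 0 = 0) :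
    ∃ A : E → E →L[𝕜] F, AnalyticAt 𝕜 A 0 ∧ ∀ᶠ x in 𝓝 (0 : E), f x = A x x := by
  obtain ⟨q, r, h⟩ := hf
  have hr : 0 < q.shift.radius := by
    rw [FormalMultilinearSeries.radius_shift]; exact h.r_pos.trans_le h.r_le
  have hA := q.shift.hasFPowerSeriesOnBall hr
  refine ⟨q.shift.sum, ⟨_, hA.hasFPowerSeriesAt⟩, ?_⟩
  filter_upwards [Metric.eball_mem_nhds (0 : E) h.r_pos,
    Metric.eball_mem_nhds (0 : E) hr] with x hx hx'
  have h1 := (ContinuousLinearMap.apply 𝕜 F x).hasSum (hA.hasSum hx')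
  have h2 := h.hasSum hx
  rw [← hasSum_nat_add_iff' 1] at h2
  simp only [zero_add] at h1 h2
  have h3 : ∑ i ∈ Finset.range 1, q i (fun _ => x) = 0 := by
    simp only [Finset.range_one, Finset.sum_singleton]
    rw [h.hasFPowerSeriesAt.coeff_zero, h0]
  rw [h3, sub_zero] at h2
  refine h2.unique ?_
  have h4 : (fun n => (ContinuousLinearMap.apply 𝕜 F x) (q.shift n fun _ => x)) =
      fun n => q (n + 1) fun _ => x := by
    funext n
    simp only [ContinuousLinearMap.apply_apply, FormalMultilinearSeries.shift,
      ContinuousMultilinearMap.curryRight_apply]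
    congr 1
    exact Fin.snoc_init_self (fun _ : Fin (n + 1) => x)
  rw [h4] at h1
  exact h1

theorem AnalyticAt.clm_apply {𝕜 E F G : Type*} [NontriviallyNormedField 𝕜]
    [NormedAddCommGroup E] [NormedSpace 𝕜 E] [NormedAddCommGroup F] [NormedSpace 𝕜 F]
    [NormedAddCommGroup G] [NormedSpace 𝕜 G] {A : E → F →L[𝕜] G} {u : E → F} {x : E}
    (hA : AnalyticAt 𝕜 A x) (hu : AnalyticAt 𝕜 u x) : AnalyticAt 𝕜 (fun y => A y (u y)) x :=
  AnalyticAt.comp (f := fun y => (A y, u y))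
    ((ContinuousLinearMap.id 𝕜 (F →L[𝕜] G)).analyticAt_bilinear (A x, u x)) (hA.prod hu)

/-- The second order form of Hadamard's lemma. -/
theorem AnalyticAt.exists_eventually_eq_apply_apply {𝕜 E F : Type*} [NontriviallyNormedField 𝕜]
    [NormedAddCommGroup E] [NormedSpace 𝕜 E] [NormedAddCommGroup F] [NormedSpace 𝕜 F]
    [CompleteSpace F] {f : E → F} (hf : AnalyticAt 𝕜 f 0) (h0 : f 0 = 0)
    (h1 : fderiv 𝕜 f 0 = 0) :
    ∃ B : E → E →L[𝕜] E →L[𝕜] F, AnalyticAt 𝕜 B 0 ∧ ∀ᶠ x in 𝓝 (0 : E), f x = B x x x := by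
  obtain ⟨A, hA, hfA⟩ := hf.exists_eventually_eq_apply h0
  have hA0 : A 0 = 0 := by
    have h := hA.differentiableAt.hasFDerivAt.clm_apply (hasFDerivAt_id (0 : E))
    simp only [id] at h
    rw [(Filter.EventuallyEq.fderiv_eq hfA), h.fderiv] at h1
    ext v
    simpa using DFunLike.congr_fun h1 v
  obtain ⟨B, hB, hAB⟩ := hA.exists_eventually_eq_apply hA0
  refine ⟨B, hB, ?_⟩
  filter_upwards [hfA, hAB] with x h2 h3
  rw [h2, h3]

theorem fderiv_fderiv_of_eventually_eq_apply_apply {𝕜 E F : Type*} [NontriviallyNormedField 𝕜]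
    [NormedAddCommGroup E] [NormedSpace 𝕜 E] [NormedAddCommGroup F] [NormedSpace 𝕜 F]
    [CompleteSpace F] {f : E → F} {B : E → E →L[𝕜] E →L[𝕜] F} (hB : AnalyticAt 𝕜 B 0)
    (h : ∀ᶠ x in 𝓝 (0 : E), f x = B x x x) (u v : E) :
    fderiv 𝕜 (fderiv 𝕜 f) 0 u v = B 0 u v + B 0 v u := by
  have h1 : ∀ᶠ x in 𝓝 (0 : E), fderiv 𝕜 f x =
      (B x x) + (B x).flip x + ((fderiv 𝕜 B x).flip x).flip x := by
    filter_upwards [h.eventually_nhds, hB.eventually_analyticAt] with x hx hBx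
    rw [Filter.EventuallyEq.fderiv_eq hx]
    have := (hBx.differentiableAt.hasFDerivAt.clm_apply (hasFDerivAt_id x)).clm_apply
      (hasFDerivAt_id x)
    have h2 := this.fderiv
    simp only [id] at h2
    rw [h2]
    ext w
    simp [add_assoc]
  have h2 : ∀ᶠ x in 𝓝 (0 : E), fderiv 𝕜 f x v = B x v x + B x x v + fderiv 𝕜 B x v x x := by
    filter_upwards [h1] with x hx
    simp [hx, add_comm]
  have hd : DifferentiableAt 𝕜 (fderiv 𝕜 f) 0 := by
    have : AnalyticAt 𝕜 f 0 := ((hB.clm_apply analyticAt_id).clm_apply analyticAt_id).congr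
      (h.mono fun x hx => hx.symm)
    exact this.fderiv.differentiableAt
  have e1 := hB.differentiableAt.hasFDerivAt
  have e2 := hB.fderiv.differentiableAt.hasFDerivAt
  have i := hasFDerivAt_id (𝕜 := 𝕜) (0 : E)
  have c := hasFDerivAt_const (𝕜 := 𝕜) v (0 : E)
  have e5 := ((((e1.clm_apply c).clm_apply i).add ((e1.clm_apply i).clm_apply c)).add
    (((e2.clm_apply c).clm_apply i).clm_apply i)).congr_of_eventuallyEq h2
  have e6 := (hd.hasFDerivAt.clm_apply c).unique e5
  have e7 := DFunLike.congr_fun e6 u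
  simpa [add_comm] using e7

/-- Square roots near `1` in a Banach algebra, from the inverse function theorem: the squaring map
has the invertible derivative `2` at `1`. -/
theorem exists_analyticAt_sqrt {R : Type*} [NormedRing R] [NormedAlgebra ℝ R] [CompleteSpace R] :
    ∃ ρ : R → R, AnalyticAt ℝ ρ 1 ∧ ρ 1 = 1 ∧ (∀ᶠ a in 𝓝 (1 : R), ρ a * ρ a = a) ∧
      ∀ᶠ b in 𝓝 (1 : R), ρ (b * b) = b := by
  let f : R → R := fun b => b * b
  have hf : AnalyticAt ℝ f 1 := analyticAt_id.mul analyticAt_id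
  have hf' : HasFDerivAt f ((ContinuousLinearEquiv.smulLeft (Units.mk0 (2 : ℝ) two_ne_zero) :
      R ≃L[ℝ] R) : R →L[ℝ] R) 1 := by
    have h := (hasFDerivAt_id (𝕜 := ℝ) (1 : R)).mul' (hasFDerivAt_id (1 : R))
    refine h.congr_fderiv ?_
    ext v
    simp [two_smul, Units.smul_def]
  have hc : ContDiffAt ℝ ω f 1 := hf.contDiffAt
  have hs := hc.hasStrictFDerivAt' hf' (by simp)
  have h1 : f 1 = 1 := by simp [f]
  refine ⟨hc.localInverse hf' (by simp), ?_, ?_, ?_, ?_⟩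
  · have := hc.to_localInverse hf' (by simp)
    rw [h1] at this
    exact this.analyticAt
  · have := hc.localInverse_apply_image hf' (by simp)
    rwa [h1] at this
  · have := hs.eventually_right_inverse
    rwa [h1] at this
  · exact hs.eventually_left_inverse

open scoped InnerProductSpace in
/-- The **Morse lemma** for an analytic function on a finite-dimensional Euclidean space. If the
Hessian at the critical point `0` is represented by an invertible operator `T`, then
`Q = ½ ⟪T φ, φ⟫` for an analytic change of coordinates `φ` tangent to the identity.
By Hadamard's lemma `Q x = ½ ⟪S x x, x⟫` with `S` analytic and self-adjoint, `S 0 = T`; then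
`φ x = √(T⁻¹ S x) x`, since the square root is self-adjoint relative to `T`. -/
theorem AnalyticAt.morse_lemma {W : Type*} [NormedAddCommGroup W] [InnerProductSpace ℝ W]
    [FiniteDimensional ℝ W] {Q : W → ℝ} (hQ : AnalyticAt ℝ Q 0) (h0 : Q 0 = 0)
    (h1 : fderiv ℝ Q 0 = 0) (T : W ≃L[ℝ] W)
    (hT : ∀ u v, fderiv ℝ (fderiv ℝ Q) 0 u v = ⟪T u, v⟫_ℝ) :
    ∃ φ : W → W, AnalyticAt ℝ φ 0 ∧ φ 0 = 0 ∧ HasFDerivAt φ (ContinuousLinearMap.id ℝ W) 0 ∧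
      ∀ᶠ x in 𝓝 (0 : W), Q x = 2⁻¹ * ⟪T (φ x), φ x⟫_ℝ := by
  obtain ⟨B, hB, hQB⟩ := hQ.exists_eventually_eq_apply_apply h0 h1
  have hTB := fderiv_fderiv_of_eventually_eq_apply_apply hB hQB
  -- the Riesz isomorphism, as a linear map over `ℝ`
  let J : (W →L[ℝ] ℝ) →L[ℝ] W := LinearMap.toContinuousLinearMap
    { toFun := (InnerProductSpace.toDual ℝ W).symm
      map_add' := fun a b => map_add _ a b
      map_smul' := fun c a => by simp }
  have hJ : ∀ a v, ⟪J a, v⟫_ℝ = a v := fun a v => InnerProductSpace.toDual_symm_apply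
  let Ti : W →L[ℝ] W := T.symm
  let T₀ : W →L[ℝ] W := T
  let S : W → W →L[ℝ] W := fun x => J.comp (B x + (B x).flip)
  have hS : AnalyticAt ℝ S 0 := by
    let Λ : (W →L[ℝ] W →L[ℝ] ℝ) →L[ℝ] W →L[ℝ] W := LinearMap.toContinuousLinearMap
      { toFun := fun b => J.comp (b + b.flip)
        map_add' := fun b b' => by
          ext
          simp only [ContinuousLinearMap.flip_add, ContinuousLinearMap.comp_apply, add_apply,
            map_add]
          abel
        map_smul' := fun c b => by ext; simp }
    exact (Λ.analyticAt _).comp hB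
  have hSi : ∀ x u v, ⟪S x u, v⟫_ℝ = B x u v + B x v u := fun x u v => by 
    simp only [S, ContinuousLinearMap.comp_apply, map_add, add_apply, inner_add_left, hJ,
      ContinuousLinearMap.flip_apply]
  have hS0 : S 0 = T₀ := by
    ext u
    refine ext_inner_right ℝ fun v => ?_
    rw [hSi, ← hTB, hT]; rfl
  have hSsa : ∀ x, ContinuousLinearMap.adjoint (S x) = S x := fun x => by
    ext u
    refine ext_inner_right ℝ fun v => ?_
    rw [ContinuousLinearMap.adjoint_inner_left, real_inner_comm, hSi, hSi, add_comm]
  have hTsa : ContinuousLinearMap.adjoint T₀ = T₀ := hS0 ▸ hSsa 0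
  have hTiT : Ti * T₀ = 1 := by ext x; simp [Ti, T₀]
  have hTTi : T₀ * Ti = 1 := by ext x; simp [Ti, T₀]
  have hTisa : ContinuousLinearMap.adjoint Ti = Ti := by
    have : star Ti * T₀ = 1 := by
      have h := congrArg star hTTi
      rw [star_mul, star_one, ContinuousLinearMap.star_eq_adjoint T₀, hTsa] at h
      exact h
    calc star Ti = star Ti * (T₀ * Ti) := by rw [hTTi, mul_one]
      _ = Ti := by rw [← mul_assoc, this, one_mul]
  obtain ⟨ρ, hρ, hρ1, hρr, hρl⟩ := exists_analyticAt_sqrt (R := W →L[ℝ] W)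
  have hTS : AnalyticAt ℝ (fun x => Ti * S x) 0 := analyticAt_const.mul hS
  have hTS0 : Ti * S 0 = 1 := by rw [hS0, hTiT]
  let C : W → W →L[ℝ] W := fun x => ρ (Ti * S x)
  have hC : AnalyticAt ℝ C 0 := AnalyticAt.fun_comp (hTS0 ▸ hρ) hTS
  have hC0 : C 0 = 1 := by simp only [C, hTS0, hρ1]
  have hCT : Filter.Tendsto (fun x => Ti * S x) (𝓝 0) (𝓝 1) := hTS0 ▸ hTS.continuousAt.tendsto
  let D : W → W →L[ℝ] W := fun x => Ti * star (C x) * T₀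
  have hD : Filter.Tendsto D (𝓝 0) (𝓝 1) := by
    have : ContinuousAt D 0 :=
      ((continuousAt_const.mul (hC.continuousAt.star)).mul continuousAt_const)
    have hD0 : D 0 = 1 := by simp [D, hC0, hTiT]
    exact hD0 ▸ this.tendsto
  have hφ := hC.differentiableAt.hasFDerivAt.clm_apply (hasFDerivAt_id (0 : W))
  refine ⟨fun x => C x x, hC.clm_apply analyticAt_id, by simp, ?_, ?_⟩
  · refine hφ.congr_fderiv ?_
    ext v
    simp [hC0]
  · filter_upwards [hQB, hCT.eventually hρr, hD.eventually hρl] with x e1 e2 e3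
    have e2' : C x * C x = Ti * S x := e2
    have e4 : D x * D x = Ti * S x := by
      have : star (C x) * star (C x) = S x * Ti := by
        rw [← star_mul, e2', star_mul, ContinuousLinearMap.star_eq_adjoint (S x), hSsa,
          ContinuousLinearMap.star_eq_adjoint Ti, hTisa]
      calc D x * D x = Ti * star (C x) * (T₀ * Ti) * star (C x) * T₀ := by
            simp only [D, mul_assoc]
        _ = Ti * (star (C x) * star (C x)) * T₀ := by rw [hTTi, mul_one]; simp only [mul_assoc]
        _ = Ti * S x := by rw [this, mul_assoc, mul_assoc, hTiT, mul_one]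
    have e5 : D x = C x := by rw [← e3, e4]
    have e6 : star (C x) * T₀ = T₀ * C x := by
      rw [← e5]
      conv_rhs => simp only [D]
      rw [← mul_assoc, ← mul_assoc, hTTi, one_mul, e5]
    have e7 : T₀ * C x * C x = S x := by
      rw [mul_assoc, e2', ← mul_assoc, hTTi, one_mul]
    have e8 : ⟪T₀ (C x x), C x x⟫_ℝ = ⟪S x x, x⟫_ℝ := by
      rw [← e7, ← e6]
      simp [ContinuousLinearMap.star_eq_adjoint, ContinuousLinearMap.adjoint_inner_left]
    rw [show (T (C x x)) = T₀ (C x x) from rfl, e8, hSi, e1]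
    ring

/-! ### Local coordinates on manifolds and on the link complement -/

/-- The inverse function theorem for analytic maps, with an analytic local right inverse. -/
theorem AnalyticAt.exists_localInverse {E F : Type*} [NormedAddCommGroup E]
    [NormedSpace ℝ E] [CompleteSpace E] [NormedAddCommGroup F] [NormedSpace ℝ F]
    [CompleteSpace F] {f : E → F} {a : E} {f' : E ≃L[ℝ] F} (hf : AnalyticAt ℝ f a)
    (hf' : HasFDerivAt f (f' : E →L[ℝ] F) a) :
    ∃ g : F → E, AnalyticAt ℝ g (f a) ∧ g (f a) = a ∧
      HasFDerivAt g (f'.symm : F →L[ℝ] E) (f a) ∧ ∀ᶠ y in 𝓝 (f a), f (g y) = y := by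
  have hc : ContDiffAt ℝ ω f a := hf.contDiffAt
  have hs := hc.hasStrictFDerivAt' hf' (by simp)
  exact ⟨hc.localInverse hf' (by simp), (hc.to_localInverse hf' (by simp)).analyticAt,
    hc.localInverse_apply_image hf' (by simp), hs.to_localInverse.hasFDerivAt,
    hs.eventually_right_inverse⟩

/-- The inverse function theorem for analytic maps, with a partial diffeomorphism as result. -/
theorem AnalyticAt.exists_partialDiffeomorph {E F : Type*} [NormedAddCommGroup E]
    [NormedSpace ℝ E] [CompleteSpace E] [NormedAddCommGroup F] [NormedSpace ℝ F] [CompleteSpace F]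
    {f : E → F} {a : E} {f' : E ≃L[ℝ] F} (hf : AnalyticAt ℝ f a)
    (hf' : HasFDerivAt f (f' : E →L[ℝ] F) a) {U : Set E} (hU : U ∈ 𝓝 a) :
    ∃ Φ : PartialDiffeomorph 𝓘(ℝ, E) 𝓘(ℝ, F) E F ∞, a ∈ Φ.source ∧ Φ.source ⊆ U ∧
      (Φ : E → F) = f := by
  have hc : ContDiffAt ℝ ω f a := hf.contDiffAt
  let e := hc.toOpenPartialHomeomorph f hf' (by simp)
  have hinv : AnalyticAt ℝ e.symm (f a) := (hc.to_localInverse hf' (by simp)).analyticAt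
  have hae : a ∈ e.source := hc.mem_toOpenPartialHomeomorph_source hf' (by simp)
  let S : Set E := interior U ∩ {x | AnalyticAt ℝ f x}
  have hS : IsOpen S := isOpen_interior.inter (isOpen_analyticAt ℝ f)
  let T : Set F := {y | AnalyticAt ℝ e.symm y}
  have hT : IsOpen T := isOpen_analyticAt ℝ e.symm
  let e₁ := ((e.restrOpen S hS).symm.restrOpen T hT).symm
  have hsrc : ∀ x, x ∈ e₁.source ↔ x ∈ e.source ∧ x ∈ S ∧ f x ∈ T := by
    intro x
    constructor
    · intro hx
      have h2 := e₁.map_source hx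
      have h3 : x ∈ e.source ∩ S := by
        have := (e.restrOpen S hS).symm.symm.symm.map_source h2.1
        have h4 := e₁.left_inv hx
        change _ = x at h4
        rw [← h4]
        exact this
      exact ⟨h3.1, h3.2, h2.2⟩
    · rintro ⟨h1, h2, h3⟩
      have h5 : e.symm (f x) = x := e.left_inv h1
      have h4 : f x ∈ e₁.target := by
        refine ⟨⟨e.map_source h1, ?_⟩, h3⟩
        change e.symm (f x) ∈ S
        rwa [h5]
      have := e₁.symm.map_source h4
      change e.symm (f x) ∈ e₁.source at this
      rwa [h5] at this
  refine ⟨{ toPartialEquiv := e₁.toPartialEquiv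
            open_source := e₁.open_source
            open_target := e₁.open_target
            contMDiffOn_toFun := ?_
            contMDiffOn_invFun := ?_ }, ?_, ?_, rfl⟩
  · intro x hx
    exact ((((hsrc x).1 hx).2.1.2).contDiffAt.contMDiffAt).contMDiffWithinAt
  · intro y hy
    have hyT : AnalyticAt ℝ e.symm y := hy.2
    exact (hyT.contDiffAt.contMDiffAt).contMDiffWithinAt
  · exact (hsrc a).2 ⟨hae, ⟨mem_interior_iff_mem_nhds.2 hU, hf⟩, hinv⟩
  · intro x hx
    exact interior_subset ((hsrc x).1 hx).2.1.1

/-- A map on an analytic manifold whose expression in the preferred chart at `p` is analytic with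
invertible derivative is a local coordinate system near `p`. -/
theorem exists_partialDiffeomorph_of_chart {E V M : Type*} [NormedAddCommGroup E]
    [NormedSpace ℝ E] [CompleteSpace E] [NormedAddCommGroup V] [NormedSpace ℝ V] [CompleteSpace V]
    [TopologicalSpace M] [ChartedSpace E M] [IsManifold 𝓘(ℝ, E) ∞ M] {F : M → V} {p : M}
    {f' : E ≃L[ℝ] V} (hF : AnalyticAt ℝ (F ∘ (chartAt E p).symm) (chartAt E p p))
    (hF' : HasFDerivAt (F ∘ (chartAt E p).symm) (f' : E →L[ℝ] V) (chartAt E p p))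
    {U : Set M} (hU : U ∈ 𝓝 p) :
    ∃ x : PartialDiffeomorph 𝓘(ℝ, E) 𝓘(ℝ, V) M V ∞, p ∈ x.source ∧ x.source ⊆ U ∧
      ∀ q ∈ x.source, x q = F q := by
  let e : PartialDiffeomorph 𝓘(ℝ, E) 𝓘(ℝ, E) M E ∞ :=
    { toPartialEquiv := (chartAt E p).toPartialEquiv
      open_source := (chartAt E p).open_source
      open_target := (chartAt E p).open_target
      contMDiffOn_toFun := contMDiffOn_chart
      contMDiffOn_invFun := contMDiffOn_chart_symm }
  have hp := mem_chart_source E p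
  have hU' : (chartAt E p).symm ⁻¹' U ∈ 𝓝 (chartAt E p p) := by
    apply ((chartAt E p).continuousAt_symm (mem_chart_target E p)).preimage_mem_nhds
    rwa [(chartAt E p).left_inv hp]
  obtain ⟨Φ, h1, h2, h3⟩ := hF.exists_partialDiffeomorph hF' hU'
  refine ⟨e.trans Φ, ⟨hp, h1⟩, ?_, ?_⟩
  · rintro q ⟨hq1, hq2⟩
    have := h2 hq2
    change (chartAt E p).symm (chartAt E p q) ∈ U at this
    rwa [(chartAt E p).left_inv hq1] at this
  · rintro q ⟨hq1, hq2⟩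
    change Φ (chartAt E p q) = F q
    rw [h3]
    exact congrArg F ((chartAt E p).left_inv hq1)

namespace CSphere

variable {n : ℕ} [n.AtLeastTwo] {ε : ℝ} [Fact (0 < ε)]

theorem contMDiff_val : ContMDiff (𝓡 (2 * n - 1)) 𝓘(ℝ, Cn n) ω (val : CSphere n ε → Cn n) := by
  rw [contMDiff_iff]
  refine ⟨continuous_val, fun z _ => ?_⟩
  let v : Metric.sphere (0 : Cn n) 1 := -toUnit n ε z
  let U := (OrthonormalBasis.fromOrthogonalSpanSingleton (𝕜 := ℝ) (2 * n - 1)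
    (ne_zero_of_mem_unit_sphere v)).repr
  exact (((contDiff_stereoInvFunAux.comp (ℝ ∙ (v : Cn n))ᗮ.subtypeL.contDiff).comp
    U.symm.contDiff).const_smul ε).contDiffOn

omit [n.AtLeastTwo] [Fact (0 < ε)] in
theorem norm_val (z : CSphere n ε) : ‖z.val‖ = ε := by
  simpa using (show z.val ∈ Metric.sphere (0 : Cn n) ε from z.2)

end CSphere

section

variable {n : ℕ} [n.AtLeastTwo] {ε : ℝ} [Fact (0 < ε)] {f g : MvPolynomial (Fin n) ℂ}

theorem contMDiff_linkComplement_val :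
    ContMDiff (𝓡 (2 * n - 1)) 𝓘(ℝ, Cn n) ω (fun q : linkComplement f g ε => q.1.val) :=
  CSphere.contMDiff_val.comp contMDiff_subtype_val

/-- The preferred chart at `p` of the link complement is the restriction of a map that is smooth
on an open subset of `ℂⁿ`. -/
theorem exists_extension_chartAt (p : linkComplement f g ε) :
    ∃ C : Cn n → EuclideanSpace ℝ (Fin (2 * n - 1)), DifferentiableAt ℝ C p.1.val ∧
      ∀ q : linkComplement f g ε,
        chartAt (EuclideanSpace ℝ (Fin (2 * n - 1))) p q = C q.1.val := by
  let v : Metric.sphere (0 : Cn n) 1 := -CSphere.toUnit n ε p.1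
  refine ⟨fun z => (OrthonormalBasis.fromOrthogonalSpanSingleton (2 * n - 1)
    (ne_zero_of_mem_unit_sphere v)).repr (stereoToFun (v : Cn n) (ε⁻¹ • z)), ?_, ?_⟩
  · have hm : p.1.val ∈ {z : Cn n | inner ℝ (v : Cn n) (ε⁻¹ • z) ≠ (1 : ℝ)} := by
      have h1 : ε⁻¹ • p.1.val = -(v : Cn n) := (neg_neg _).symm
      rw [Set.mem_ofPred_eq, h1, inner_neg_right, real_inner_self_eq_norm_sq]
      norm_num
    have ho : IsOpen {z : Cn n | inner ℝ (v : Cn n) (ε⁻¹ • z) ≠ (1 : ℝ)} :=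
      isOpen_ne_fun (by fun_prop) continuous_const
    have h2 : ContDiffOn ℝ 1 (fun z : Cn n => stereoToFun (v : Cn n) (ε⁻¹ • z))
        {z : Cn n | inner ℝ (v : Cn n) (ε⁻¹ • z) ≠ (1 : ℝ)} :=
      contDiffOn_stereoToFun.comp (contDiff_const_smul ε⁻¹).contDiffOn fun z hz => hz
    exact (LinearIsometryEquiv.differentiableAt _).comp _
      ((h2.contDiffAt (ho.mem_nhds hm)).differentiableAt one_ne_zero)
  · intro q
    rfl

/-- The parametrization of the link complement near `p` by the inverse of the preferred chart
at `p`, as a map to `ℂⁿ`. -/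
noncomputable def linkParam (p : linkComplement f g ε)
    (y : EuclideanSpace ℝ (Fin (2 * n - 1))) : Cn n :=
  ((chartAt (EuclideanSpace ℝ (Fin (2 * n - 1))) p).symm y).1.val

theorem linkParam_chartAt (p : linkComplement f g ε) :
    linkParam p (chartAt (EuclideanSpace ℝ (Fin (2 * n - 1))) p p) = p.1.val := by
  rw [linkParam, (chartAt _ p).left_inv (mem_chart_source _ p)]

theorem analyticAt_linkParam (p : linkComplement f g ε) :
    AnalyticAt ℝ (linkParam p)
      (chartAt (EuclideanSpace ℝ (Fin (2 * n - 1))) p p) := by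
  have h1 := contMDiffOn_chart_symm (I := 𝓡 (2 * n - 1)) (n := ω) (x := p)
  have h2 := (contMDiff_linkComplement_val (f := f) (g := g) (ε := ε)).contMDiffAt.comp _
    (h1.contMDiffAt ((chartAt _ p).open_target.mem_nhds (mem_chart_target _ p)))
  exact (contMDiffAt_iff_contDiffAt.1 h2).analyticAt

theorem injective_fderiv_linkParam (p : linkComplement f g ε) :
    Function.Injective
      (fderiv ℝ (linkParam p)
        (chartAt (EuclideanSpace ℝ (Fin (2 * n - 1))) p p)) := by
  obtain ⟨C, hC, hCe⟩ := exists_extension_chartAt p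
  set e := chartAt (EuclideanSpace ℝ (Fin (2 * n - 1))) p
  have h0 : linkParam p (e p) = p.1.val := linkParam_chartAt p
  have h1 := (analyticAt_linkParam p).differentiableAt.hasFDerivAt
  have h2 : HasFDerivAt C (fderiv ℝ C p.1.val) (linkParam p (e p)) := h0 ▸ hC.hasFDerivAt
  have h3 := h2.comp (e p) h1
  have h4 : C ∘ linkParam p =ᶠ[𝓝 (e p)] id := by
    filter_upwards [e.open_target.mem_nhds (mem_chart_target _ p)] with y hy
    exact (hCe _).symm.trans (e.right_inv hy)
  have h5 := ((hasFDerivAt_id (𝕜 := ℝ) (e p)).congr_of_eventuallyEq h4).unique h3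
  refine Function.LeftInverse.injective (g := fderiv ℝ C p.1.val) fun v => ?_
  exact (DFunLike.congr_fun h5 v).symm

theorem fderiv_linkParam_orthogonal (p : linkComplement f g ε)
    (v : EuclideanSpace ℝ (Fin (2 * n - 1))) :
    (inner ℂ p.1.val
      (fderiv ℝ (linkParam p)
        (chartAt (EuclideanSpace ℝ (Fin (2 * n - 1))) p p) v)).re = 0 := by
  have h1 := (analyticAt_linkParam p).differentiableAt.hasFDerivAt
  have h2 := h1.inner ℂ h1
  have h3 : (fun y => inner ℂ (linkParam p y) (linkParam p y)) = fun _ => ((ε : ℂ) ^ 2) := by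
    funext y
    rw [inner_self_eq_norm_sq_to_K, linkParam, CSphere.norm_val]
    rfl
  rw [h3] at h2
  have h4 := DFunLike.congr_fun ((hasFDerivAt_const _ _).unique h2) v
  have h5 := congrArg Complex.re h4
  simp only [fderivInnerCLM_apply, ContinuousLinearMap.comp_apply, ContinuousLinearMap.prod_apply,
    linkParam_chartAt, Complex.add_re] at h5
  have h6 := inner_re_symm (𝕜 := ℂ) (fderiv ℝ (linkParam p) (chartAt _ p p) v) p.1.val
  change Complex.re _ = Complex.re _ at h6
  rw [h6] at h5
  change 0 = _ at h5
  linarith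

theorem finrank_re_inner_ker {p : Cn n} (hp : p ≠ 0) :
    Module.finrank ℝ
      (Complex.reLm.comp ((innerSL ℂ p).toLinearMap.restrictScalars ℝ)).ker = 2 * n - 1 := by
  have h1 : Complex.reLm.comp ((innerSL ℂ p).toLinearMap.restrictScalars ℝ) ≠ 0 := by
    intro h
    have h2 : (inner ℂ p p).re = 0 := DFunLike.congr_fun h p
    have h3 : (inner ℂ p p).re = ‖p‖ ^ 2 := inner_self_eq_norm_sq (𝕜 := ℂ) p
    rw [h3] at h2
    exact hp (by simpa using h2)
  have h2 := Module.Dual.finrank_ker_add_one_of_ne_zero h1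
  have h3 : Module.finrank ℝ (Cn n) = (2 * n - 1) + 1 := Fact.out
  omega

/-- Every vector tangent to the sphere at `p` is in the image of the differential of the
parametrization, by a count of dimensions. -/
theorem exists_fderiv_linkParam_eq (p : linkComplement f g ε) {w : Cn n}
    (hw : (inner ℂ p.1.val w).re = 0) : ∃ v,
      fderiv ℝ (linkParam p)
        (chartAt (EuclideanSpace ℝ (Fin (2 * n - 1))) p p) v = w := by
  have hp : p.1.val ≠ 0 := by
    rw [← norm_pos_iff, CSphere.norm_val]
    exact Fact.out
  have hi := injective_fderiv_linkParam p
  have ho := fderiv_linkParam_orthogonal p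
  set D := fderiv ℝ (linkParam p)
        (chartAt (EuclideanSpace ℝ (Fin (2 * n - 1))) p p)
  have hle : LinearMap.range D.toLinearMap ≤
      (Complex.reLm.comp ((innerSL ℂ p.1.val).toLinearMap.restrictScalars ℝ)).ker := by
    rintro _ ⟨v, rfl⟩
    exact ho v
  have heq := Submodule.eq_of_le_of_finrank_eq hle (by
    rw [LinearMap.finrank_range_of_inj hi, finrank_re_inner_ker hp, finrank_euclideanSpace_fin])
  have : w ∈ LinearMap.range D.toLinearMap := heq ▸ hw
  exact this

/-- An analytic map from `ℂⁿ` to a real vector space of dimension `2n - 1` whose differential is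
injective on the tangent space of the sphere gives local coordinates on the sphere. -/
theorem exists_partialDiffeomorph_linkComplement {V : Type*} [NormedAddCommGroup V]
    [NormedSpace ℝ V] [FiniteDimensional ℝ V] (hV : Module.finrank ℝ V = 2 * n - 1)
    (p : linkComplement f g ε) {F : Cn n → V} (hF : AnalyticAt ℝ F p.1.val)
    (hker : ∀ v : Cn n, (inner ℂ p.1.val v).re = 0 → fderiv ℝ F p.1.val v = 0 → v = 0)
    {U : Set (linkComplement f g ε)} (hU : U ∈ 𝓝 p) :
    ∃ x : PartialDiffeomorph (𝓡 (2 * n - 1)) 𝓘(ℝ, V) (linkComplement f g ε) V ∞,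
      p ∈ x.source ∧ x.source ⊆ U ∧ ∀ q ∈ x.source, x q = F q.1.val := by
  have : CompleteSpace V := FiniteDimensional.complete ℝ V
  set e := chartAt (EuclideanSpace ℝ (Fin (2 * n - 1))) p
  have h0 : linkParam p (e p) = p.1.val := linkParam_chartAt p
  have hκ := analyticAt_linkParam p
  have hF' : AnalyticAt ℝ F (linkParam p (e p)) := h0 ▸ hF
  have h1 : AnalyticAt ℝ (fun y => F (linkParam p y)) (e p) := AnalyticAt.fun_comp hF' hκ
  have h2 : HasFDerivAt (fun y => F (linkParam p y)) _ (e p) :=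
    hF'.differentiableAt.hasFDerivAt.comp (e p) hκ.differentiableAt.hasFDerivAt
  rw [h0] at h2
  have hinj : Function.Injective ((fderiv ℝ F p.1.val).comp
      (fderiv ℝ (linkParam p) (e p))) := by
    rw [injective_iff_map_eq_zero]
    intro v hv
    have h3 := hker _ (fderiv_linkParam_orthogonal p v) hv
    exact (injective_iff_map_eq_zero _).1 (injective_fderiv_linkParam p) v h3
  let f' : EuclideanSpace ℝ (Fin (2 * n - 1)) ≃L[ℝ] V :=
    (LinearEquiv.ofInjectiveOfFinrankEq _ hinj
      (by rw [hV, finrank_euclideanSpace_fin])).toContinuousLinearEquiv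
  have : IsManifold (𝓡 (2 * n - 1)) ∞ (linkComplement f g ε) := .of_le (n := ω) le_top
  obtain ⟨x, hx1, hx2, hx3⟩ := exists_partialDiffeomorph_of_chart
    (F := fun q : linkComplement f g ε => F q.1.val) (p := p) (f' := f') h1 (by
      refine HasFDerivAt.congr_fderiv h2 ?_
      ext1 v
      rfl) hU
  exact ⟨x, hx1, hx2, hx3⟩

end

/-! ### Fold points of maps of the form `(t, u) ↦ (t, Q u)` -/

/-- The differential of a diffeomorphism between open subsets of normed spaces is invertible. -/
theorem PartialDiffeomorph.exists_hasFDerivAt {E F : Type*} [NormedAddCommGroup E]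
    [NormedSpace ℝ E] [NormedAddCommGroup F] [NormedSpace ℝ F]
    (Ψ : PartialDiffeomorph 𝓘(ℝ, E) 𝓘(ℝ, F) E F ∞) {a : E} (ha : a ∈ Ψ.source) :
    ∃ f' : E ≃L[ℝ] F, HasFDerivAt Ψ (f' : E →L[ℝ] F) a := by
  have h1 : HasFDerivAt Ψ (fderiv ℝ Ψ a) a := ((contMDiffAt_iff_contDiffAt.1
    (Ψ.contMDiffOn_toFun.contMDiffAt (Ψ.open_source.mem_nhds ha))).differentiableAt
      (by simp)).hasFDerivAt
  have hb : Ψ a ∈ Ψ.target := Ψ.map_source ha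
  have h2 : HasFDerivAt Ψ.invFun (fderiv ℝ Ψ.invFun (Ψ a)) (Ψ a) :=
    ((contMDiffAt_iff_contDiffAt.1
    (Ψ.contMDiffOn_invFun.contMDiffAt (Ψ.open_target.mem_nhds hb))).differentiableAt
      (by simp)).hasFDerivAt
  have hba : Ψ.invFun (Ψ a) = a := Ψ.left_inv ha
  have h3 := h2.comp a h1
  have h4 : (Ψ.invFun ∘ Ψ) =ᶠ[𝓝 a] id := by
    filter_upwards [Ψ.open_source.mem_nhds ha] with x hx using Ψ.left_inv hx
  have h5 : (Ψ ∘ Ψ.invFun) =ᶠ[𝓝 (Ψ a)] id := by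
    filter_upwards [Ψ.open_target.mem_nhds hb] with x hx using Ψ.right_inv hx
  have h6 := (show HasFDerivAt Ψ (fderiv ℝ Ψ a) (Ψ.invFun (Ψ a)) from hba.symm ▸ h1).comp (Ψ a) h2
  have e1 := ((hasFDerivAt_id (𝕜 := ℝ) a).congr_of_eventuallyEq h4).unique h3
  have e2 := ((hasFDerivAt_id (𝕜 := ℝ) (Ψ a)).congr_of_eventuallyEq h5).unique h6
  exact ⟨ContinuousLinearEquiv.equivOfInverse (fderiv ℝ Ψ a) (fderiv ℝ Ψ.invFun (Ψ a))
    (fun v => (DFunLike.congr_fun e1 v).symm) (fun v => (DFunLike.congr_fun e2 v).symm), h1⟩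

/-- If `h ∘ Q` is a signed sum of squares of functions vanishing at `0`, then its second order part
at the critical point `0` of `Q` is the signed sum of the squares of the differentials. -/
theorem quadratic_part_eq_of_comp_eq {W : Type*} [NormedAddCommGroup W] [NormedSpace ℝ W]
    {k : ℕ} {Q : W → ℝ} {B : W → W →L[ℝ] W →L[ℝ] ℝ} (hB : ContinuousAt B 0)
    (hQ : ∀ᶠ w in 𝓝 (0 : W), Q w = B w w w)
    {h : ℝ → ℝ} {c : ℝ} (h0 : h 0 = 0) (hh : HasDerivAt h c 0) {a : W → Fin k → ℝ}
    {A : W →L[ℝ] Fin k → ℝ} (ha0 : a 0 = 0) (ha : HasFDerivAt a A 0) {σ : Fin k → ℝ}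
    (heq : ∀ᶠ w in 𝓝 (0 : W), h (Q w) = ∑ i, σ i * a w i ^ 2) (v : W) :
    c * B 0 v v = ∑ i, σ i * A v i ^ 2 := by
  have hline : Filter.Tendsto (fun τ : ℝ => τ • v) (𝓝 0) (𝓝 0) := by
    have : Continuous fun τ : ℝ => τ • v := by fun_prop
    simpa using this.tendsto 0
  have hline' := hline.mono_left (nhdsWithin_le_nhds (s := {0}ᶜ))
  have hb : Filter.Tendsto (fun τ : ℝ => B (τ • v) v v) (𝓝[≠] 0) (𝓝 (B 0 v v)) := by
    have : ContinuousAt (fun w => B w v v) 0 :=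
      (hB.clm_apply continuousAt_const).clm_apply continuousAt_const
    exact this.tendsto.comp hline'
  have hQ0 : Filter.Tendsto (fun τ : ℝ => τ ^ 2 * B (τ • v) v v) (𝓝[≠] 0) (𝓝 0) := by
    have h1 : Filter.Tendsto (fun τ : ℝ => τ ^ 2) (𝓝[≠] 0) (𝓝 0) := by
      have : Continuous fun τ : ℝ => τ ^ 2 := by fun_prop
      simpa using (this.tendsto 0).mono_left (nhdsWithin_le_nhds (s := {0}ᶜ))
    simpa using h1.mul hb
  have hd : Filter.Tendsto (dslope h 0) (𝓝 0) (𝓝 c) := by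
    have := (continuousAt_dslope_same.2 hh.differentiableAt).tendsto
    rwa [dslope_same, hh.deriv] at this
  have hL : Filter.Tendsto (fun τ : ℝ => dslope h 0 (τ ^ 2 * B (τ • v) v v) * B (τ • v) v v)
      (𝓝[≠] 0) (𝓝 (c * B 0 v v)) := (hd.comp hQ0).mul hb
  have hav : HasDerivAt (fun τ : ℝ => a (τ • v)) (A v) 0 := by
    have h1 : HasDerivAt (fun τ : ℝ => τ • v) v 0 := by
      simpa using (hasDerivAt_id (0 : ℝ)).smul_const v
    have h2 : HasFDerivAt a A ((0 : ℝ) • v) := by simpa using ha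
    exact h2.comp_hasDerivAt 0 h1
  have hR : Filter.Tendsto (fun τ : ℝ => ∑ i, σ i * (τ⁻¹ * a (τ • v) i) ^ 2)
      (𝓝[≠] 0) (𝓝 (∑ i, σ i * A v i ^ 2)) := by
    refine tendsto_finsetSum _ fun i _ => Filter.Tendsto.const_mul _ (Filter.Tendsto.pow ?_ 2)
    have := (hasDerivAt_pi.1 hav i).tendsto_slope_zero
    simpa [ha0] using this
  refine tendsto_nhds_unique_of_eventuallyEq hL hR ?_
  filter_upwards [hline'.eventually hQ, hline'.eventually heq, self_mem_nhdsWithin]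
    with τ h1 h2 h3
  have hτ : τ ≠ 0 := h3
  have h4 : Q (τ • v) = τ ^ 2 * B (τ • v) v v := by
    rw [h1]
    simp only [map_smul, smul_apply, smul_eq_mul]
    ring
  have h5 : h (Q (τ • v)) = dslope h 0 (Q (τ • v)) * Q (τ • v) := by
    have := sub_smul_dslope h 0 (Q (τ • v))
    rw [h0] at this
    simp only [sub_zero, smul_eq_mul] at this
    rw [← this, mul_comm]
  have h6 : ∑ i, σ i * (τ⁻¹ * a (τ • v) i) ^ 2 = (τ ^ 2)⁻¹ * ∑ i, σ i * a (τ • v) i ^ 2 := by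
    rw [Finset.mul_sum]
    refine Finset.sum_congr rfl fun i _ => ?_
    field_simp
  rw [h6, ← h2, h5, h4]
  field_simp

section FoldCriterion

variable {E H E' H' M N W : Type*}
  [NormedAddCommGroup E] [NormedSpace ℝ E] [TopologicalSpace H]
  [NormedAddCommGroup E'] [NormedSpace ℝ E'] [TopologicalSpace H']
  {I : ModelWithCorners ℝ E H} {J : ModelWithCorners ℝ E' H'}
  [TopologicalSpace M] [ChartedSpace H M] [TopologicalSpace N] [ChartedSpace H' N]
  [NormedAddCommGroup W] [InnerProductSpace ℝ W] [FiniteDimensional ℝ W]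

open scoped InnerProductSpace in
/-- A map of the form `(t, u) ↦ (t, Q u)` in suitable coordinates has a fold at a nondegenerate
critical point of `Q`: the Morse lemma and Sylvester's law of inertia turn `Q` into a signed sum of
squares without changing the coordinate `t`. -/
theorem isFoldPoint_of_nondegenerate (hW : 1 ≤ Module.finrank ℝ W) {F : M → N} {p : M}
    {Q : W → ℝ} (hQ : AnalyticAt ℝ Q 0) (hQ0 : Q 0 = 0) (hQ1 : fderiv ℝ Q 0 = 0)
    (X : PartialDiffeomorph I 𝓘(ℝ, ℝ × W) M (ℝ × W) ∞)
    (Y : PartialDiffeomorph J 𝓘(ℝ, ℝ × ℝ) N (ℝ × ℝ) ∞)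
    (hp : p ∈ X.source) (hFp : F p ∈ Y.source) (hXp : X p = 0) (hYp : Y (F p) = 0)
    (hXY : ∀ q ∈ X.source, F q ∈ Y.source ∧ Y (F q) = ((X q).1, Q (X q).2))
    (hnd : ∀ u, (∀ v, fderiv ℝ (fderiv ℝ Q) 0 u v = 0) → u = 0) : IsFoldPoint I J F p := by
  let T₁ : W →ₗ[ℝ] W :=
    { toFun := fun u => (InnerProductSpace.toDual ℝ W).symm (fderiv ℝ (fderiv ℝ Q) 0 u)
      map_add' := fun a b => by simp
      map_smul' := fun c a => by simp }
  have hT₁ : ∀ u v, ⟪T₁ u, v⟫_ℝ = fderiv ℝ (fderiv ℝ Q) 0 u v := fun u v =>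
    InnerProductSpace.toDual_symm_apply
  have hT₁i : Function.Injective T₁ := by
    rw [injective_iff_map_eq_zero]
    intro u hu
    refine hnd u fun v => ?_
    rw [← hT₁, hu, inner_zero_left]
  let T : W ≃L[ℝ] W := (LinearEquiv.ofInjectiveEndo T₁ hT₁i).toContinuousLinearEquiv
  have hT : ∀ u v, fderiv ℝ (fderiv ℝ Q) 0 u v = ⟪T u, v⟫_ℝ := fun u v => (hT₁ u v).symm
  obtain ⟨φ, hφ, hφ0, hφ1, hφQ⟩ := hQ.morse_lemma hQ0 hQ1 T hT
  have hsymm : ∀ u v, ⟪T u, v⟫_ℝ = ⟪T v, u⟫_ℝ := by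
    intro u v
    rw [← hT, ← hT]
    exact (hQ.contDiffAt (n := 2)).isSymmSndFDerivAt (by simp) u v
  -- Sylvester's law of inertia diagonalizes the Hessian
  let bl : LinearMap.BilinForm ℝ W := LinearMap.mk₂ ℝ (fun u v => 2⁻¹ * ⟪T u, v⟫_ℝ)
    (fun a b c => by simp [inner_add_left, mul_add])
    (fun r a b => by simp [inner_smul_left]; ring)
    (fun a b c => by simp [inner_add_right, mul_add])
    (fun r a b => by simp [inner_smul_right]; ring)
  have hbl : bl.IsSymm := ⟨fun u v => by simp [bl, hsymm u v]⟩
  have hsep : (QuadraticMap.associated (R := ℝ) bl.toQuadraticMap).SeparatingLeft := by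
    rw [QuadraticMap.associated_left_inverse ℝ hbl.eq]
    intro u hu
    have h1 : T u = 0 := by
      refine ext_inner_right ℝ fun v => ?_
      have := hu v
      simp only [bl, LinearMap.mk₂_apply] at this
      rw [inner_zero_left]
      linarith
    exact T.injective (h1.trans (map_zero T).symm)
  obtain ⟨σ, hσ, ⟨L⟩⟩ := QuadraticForm.equivalent_one_neg_one_weighted_sum_squared _ hsep
  let L' : W ≃L[ℝ] (Fin (Module.finrank ℝ W) → ℝ) := L.toLinearEquiv.toContinuousLinearEquiv
  have hL : ∀ u, 2⁻¹ * ⟪T u, u⟫_ℝ = ∑ i, σ i * L' u i ^ 2 := by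
    intro u
    have := L.map_app u
    simp only [QuadraticMap.weightedSumSquares_apply] at this
    refine this.symm.trans (Finset.sum_congr rfl fun i _ => ?_)
    rw [smul_eq_mul, pow_two]
    rfl
  let Z : ℝ × W → ℝ × (Fin (Module.finrank ℝ W) → ℝ) := fun z => (z.1, L' (φ z.2))
  have hφ' : AnalyticAt ℝ φ (0 : ℝ × W).2 := hφ
  have hZ : AnalyticAt ℝ Z 0 := analyticAt_fst.prod
    ((L'.analyticAt _).comp (hφ'.fun_comp analyticAt_snd))
  have hZ' : HasFDerivAt Z (((ContinuousLinearEquiv.refl ℝ ℝ).prodCongr L' :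
      (ℝ × W) ≃L[ℝ] _) : ℝ × W →L[ℝ] _) 0 := by
    have h1 : HasFDerivAt φ (ContinuousLinearMap.id ℝ W) (0 : ℝ × W).2 := hφ1
    have h2 := (hasFDerivAt_fst (𝕜 := ℝ) (p := (0 : ℝ × W))).prodMk
      (L'.hasFDerivAt.comp _ (h1.comp (0 : ℝ × W) hasFDerivAt_snd))
    exact h2.congr_fderiv (ContinuousLinearMap.ext fun v => rfl)
  have hU : {z : ℝ × W | Q z.2 = 2⁻¹ * ⟪T (φ z.2), φ z.2⟫_ℝ} ∈ 𝓝 (0 : ℝ × W) :=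
    (continuous_snd.tendsto (0 : ℝ × W)).eventually hφQ
  obtain ⟨Θ, hΘ0, hΘU, hΘ⟩ := hZ.exists_partialDiffeomorph hZ' hU
  have hXp' : X.toFun p = 0 := hXp
  refine ⟨_, X.trans Θ, Y, σ, hW, fun i => (hσ i).symm, ⟨hp, ?_⟩, hFp, ?_, hYp, ?_⟩
  · change X p ∈ Θ.source
    rwa [hXp]
  · change Θ (X p) = 0
    rw [hXp, hΘ]
    simp [Z, hφ0]
  · rintro q ⟨hq1, hq2⟩
    refine ⟨(hXY q hq1).1, ?_⟩
    have h1 : (X.trans Θ) q = Z (X q) := congrFun hΘ (X q)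
    have h2 : Q (X q).2 = 2⁻¹ * ⟪T (φ (X q).2), φ (X q).2⟫_ℝ := hΘU hq2
    rw [(hXY q hq1).2, h1, h2, hL]

/-- If a map of the form `(t, u) ↦ (t, Q u)` in suitable coordinates has a fold at the critical
point `0` of `Q`, then the Hessian of `Q` is nondegenerate. The change of coordinates `A` on the
kernel of the differential is an isomorphism that carries the Hessian, up to a factor, to the signed
sum of squares; a vector in the radical of the Hessian is therefore killed by `A`. -/
theorem nondegenerate_of_isFoldPoint {F : M → N} {p : M}
    {Q : W → ℝ} (hQ : AnalyticAt ℝ Q 0) (hQ0 : Q 0 = 0) (hQ1 : fderiv ℝ Q 0 = 0)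
    (X : PartialDiffeomorph I 𝓘(ℝ, ℝ × W) M (ℝ × W) ∞)
    (Y : PartialDiffeomorph J 𝓘(ℝ, ℝ × ℝ) N (ℝ × ℝ) ∞)
    (hp : p ∈ X.source) (hFp : F p ∈ Y.source) (hXp : X p = 0) (hYp : Y (F p) = 0)
    (hXY : ∀ q ∈ X.source, F q ∈ Y.source ∧ Y (F q) = ((X q).1, Q (X q).2))
    (hfold : IsFoldPoint I J F p) {u : W} (hu : ∀ v, fderiv ℝ (fderiv ℝ Q) 0 u v = 0) :
    u = 0 := by
  obtain ⟨k, x, y, σ, -, hσ, hpx, hFpy, hx0, hy0, hxy⟩ := hfold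
  obtain ⟨B, hB, hQB⟩ := hQ.exists_eventually_eq_apply_apply hQ0 hQ1
  have hTB := fderiv_fderiv_of_eventually_eq_apply_apply hB hQB
  have hXs : X.invFun 0 = p := by rw [← hXp]; exact X.left_inv hp
  have hYs : Y.invFun 0 = F p := by rw [← hYp]; exact Y.left_inv hFp
  have hξ0 : (0 : ℝ × W) ∈ (X.symm.trans x).source := by
    refine ⟨?_, ?_⟩
    · rw [← hXp]; exact X.map_source hp
    · change X.invFun 0 ∈ x.source
      rwa [hXs]
  have hη0 : (0 : ℝ × ℝ) ∈ (Y.symm.trans y).source := by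
    refine ⟨?_, ?_⟩
    · rw [← hYp]; exact Y.map_source hFp
    · change Y.invFun 0 ∈ y.source
      rwa [hYs]
  obtain ⟨ξ', hξ'⟩ := (X.symm.trans x).exists_hasFDerivAt hξ0
  obtain ⟨η', hη'⟩ := (Y.symm.trans y).exists_hasFDerivAt hη0
  let ξ : ℝ × W → ℝ × (Fin k → ℝ) := fun z => x (X.invFun z)
  let η : ℝ × ℝ → ℝ × ℝ := fun z => y (Y.invFun z)
  change HasFDerivAt ξ _ _ at hξ'
  change HasFDerivAt η _ _ at hη'
  have hξz : ξ 0 = 0 := by simp only [ξ, hXs]; exact hx0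
  have hηz : η 0 = 0 := by simp only [η, hYs]; exact hy0
  -- the map read in the two pairs of coordinates, on the slice where the first coordinate is `0`
  have key : ∀ᶠ w in 𝓝 (0 : W), η (0, Q w) =
      ((ξ (0, w)).1, ∑ i, σ i * (ξ (0, w)).2 i ^ 2) := by
    have hc : Filter.Tendsto (fun w : W => ((0 : ℝ), w)) (𝓝 0) (𝓝 0) := by
      have : Continuous fun w : W => ((0 : ℝ), w) := by fun_prop
      exact this.tendsto 0
    filter_upwards [hc.eventually ((X.symm.trans x).open_source.mem_nhds hξ0)] with w hw
    obtain ⟨hw1, hw2⟩ := hw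
    have h1 : X.invFun (0, w) ∈ X.source := X.map_target hw1
    have h2 : X (X.invFun (0, w)) = (0, w) := X.right_inv hw1
    obtain ⟨h3, h4⟩ := hXY _ h1
    rw [h2] at h4
    have h5 : Y.invFun (0, Q w) = F (X.invFun (0, w)) := by
      rw [← h4]; exact Y.left_inv h3
    have h6 := (hxy _ hw2).2
    simp only [η, h5]
    exact h6
  have hinr : HasFDerivAt (fun w : W => ((0 : ℝ), w)) (ContinuousLinearMap.inr ℝ ℝ W) 0 :=
    (ContinuousLinearMap.inr ℝ ℝ W).hasFDerivAt
  have hξ1 : HasFDerivAt (fun w : W => ξ (0, w))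
      ((ξ' : ℝ × W →L[ℝ] _).comp (ContinuousLinearMap.inr ℝ ℝ W)) 0 :=
    HasFDerivAt.comp (0 : W) (g := ξ) (f := fun w : W => ((0 : ℝ), w)) hξ' hinr
  have hξ1a := hξ1.fst
  have hξ1b := hξ1.snd
  have hfirst : ∀ v, (ξ' (0, v)).1 = 0 := by
    have h1 : HasFDerivAt (fun w : W => ((0 : ℝ), Q w)) (0 : W →L[ℝ] ℝ × ℝ) 0 := by
      have := (hasFDerivAt_const (0 : ℝ) (0 : W)).prodMk (hQ1 ▸ hQ.differentiableAt.hasFDerivAt)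
      exact this
    have h1' : HasFDerivAt η (η' : ℝ × ℝ →L[ℝ] _) ((0 : ℝ), Q 0) := by rw [hQ0]; exact hη'
    have h2 := (HasFDerivAt.comp (0 : W) (g := η) (f := fun w : W => ((0 : ℝ), Q w)) h1' h1).fst
    have h3 : (fun w : W => (ξ (0, w)).1) =ᶠ[𝓝 0] fun w => ((η ∘ fun w => (0, Q w)) w).1 := by
      filter_upwards [key] with w hw
      simp [hw]
    intro v
    have h4 := DFunLike.congr_fun (hξ1a.unique (h2.congr_of_eventuallyEq h3)) v
    simpa using h4
  let A : W →L[ℝ] (Fin k → ℝ) := (ContinuousLinearMap.snd ℝ ℝ (Fin k → ℝ)).comp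
    ((ξ' : ℝ × W →L[ℝ] _).comp (ContinuousLinearMap.inr ℝ ℝ W))
  have hAi : Function.Injective A := by
    rw [injective_iff_map_eq_zero]
    intro v hv
    have h1 : ξ' (0, v) = 0 := Prod.ext (hfirst v) hv
    exact (Prod.ext_iff.1 ((map_eq_zero_iff ξ' ξ'.injective).1 h1)).2
  have hdim : Module.finrank ℝ W = Module.finrank ℝ (Fin k → ℝ) := by
    have := ξ'.toLinearEquiv.finrank_eq
    rw [Module.finrank_prod, Module.finrank_prod] at this
    omega
  have hAs : Function.Surjective A :=
    (LinearMap.injective_iff_surjective_of_finrank_eq_finrank (f := A.toLinearMap) hdim).1 hAi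
  have hh : HasDerivAt (fun s : ℝ => (η (0, s)).2) (η' (0, 1)).2 0 := by
    have h1 : HasDerivAt (fun s : ℝ => ((0 : ℝ), s)) ((0 : ℝ), (1 : ℝ)) 0 :=
      (hasDerivAt_const (0 : ℝ) (0 : ℝ)).prodMk (hasDerivAt_id (0 : ℝ))
    have h2 : HasFDerivAt (fun z : ℝ × ℝ => (η z).2) _ ((0 : ℝ), (0 : ℝ)) := hη'.snd
    exact h2.comp_hasDerivAt (0 : ℝ) h1
  have hquad := quadratic_part_eq_of_comp_eq (A := A) (σ := σ) hB.continuousAt hQB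
    (h := fun s => (η (0, s)).2) (by change (η 0).2 = 0; rw [hηz]; rfl) hh
    (a := fun w => (ξ (0, w)).2) (by change (ξ 0).2 = 0; rw [hξz]; rfl) hξ1b
    (by filter_upwards [key] with w hw; rw [hw])
  have hpol : ∀ v, ∑ i, σ i * (A u i * A v i) = 0 := by
    intro v
    have h1 := hquad (u + v)
    have h2 := hquad u
    have h3 := hquad v
    have h4 := hu v
    rw [hTB] at h4
    have h5 : ∑ i, σ i * A (u + v) i ^ 2 = ∑ i, σ i * A u i ^ 2 + ∑ i, σ i * A v i ^ 2 +
        2 * ∑ i, σ i * (A u i * A v i) := by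
      rw [Finset.mul_sum, ← Finset.sum_add_distrib, ← Finset.sum_add_distrib]
      refine Finset.sum_congr rfl fun i _ => ?_
      rw [map_add, Pi.add_apply]
      ring
    simp only [map_add, add_apply] at h1 h5
    rw [h5, ← h2, ← h3] at h1
    have h6 : (η' (0, 1)).2 * (B 0 u v + B 0 v u) = 2 * ∑ i, σ i * (A u i * A v i) := by
      linarith
    rw [h4, mul_zero] at h6
    linarith
  refine hAi ?_
  rw [map_zero]
  funext i
  obtain ⟨v, hv⟩ := hAs (Pi.single i 1)
  have h1 := hpol v
  rw [hv, Finset.sum_eq_single i (fun j _ hj => by simp [hj]) (by simp)] at h1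
  rcases hσ i with h | h <;> simpa [h] using h1

end FoldCriterion

/-! ### Sheared angular coordinates on the torus -/

theorem contMDiffAt_arg_circle (ζ₀ : Circle) {ζ : Circle}
    (hζ : ((ζ₀⁻¹ * ζ : Circle) : ℂ) ∈ Complex.slitPlane) :
    ContMDiffAt (𝓡 1) 𝓘(ℝ, ℝ) ∞ (fun z : Circle => Complex.arg ((ζ₀⁻¹ * z : Circle) : ℂ)) ζ := by
  have h1 : ContMDiff (𝓡 1) 𝓘(ℝ, ℂ) ∞ (fun z : Circle => ((ζ₀⁻¹ * z : Circle) : ℂ)) := by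
    have h2 : ContMDiff (𝓡 1) (𝓡 1) ∞ (fun z : Circle => ζ₀⁻¹ * z) := contMDiff_mul_left
    have h3 : Fact (Module.finrank ℝ ℂ = 1 + 1) := finrank_real_complex_fact'
    exact (contMDiff_coe_sphere (E := ℂ) (n := 1)).comp h2
  have h4 : ContDiffAt ℝ ∞ Complex.arg ((ζ₀⁻¹ * ζ : Circle) : ℂ) := by
    have : Complex.arg = fun z => (Complex.log z).im := by funext z; rw [Complex.log_im]
    rw [this]
    exact Complex.imCLM.contDiff.contDiffAt.comp _
      ((Complex.contDiffAt_log hζ).restrict_scalars ℝ)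
  exact h4.contMDiffAt.comp ζ h1.contMDiffAt

/-- Sheared angular coordinates on the torus, centred at a given point: the coordinates of
`(ζ₁ exp (i a), ζ₂ exp (i b))` are `(a, b - s a)`. -/
theorem exists_torus_coordinates (s : ℝ) (ζ : Circle × Circle) :
    ∃ Y : PartialDiffeomorph ((𝓡 1).prod (𝓡 1)) 𝓘(ℝ, ℝ × ℝ) (Circle × Circle) (ℝ × ℝ) ∞,
      ζ ∈ Y.source ∧ Y ζ = 0 ∧ ∀ a b : ℝ, |a| < Real.pi → |b| < Real.pi →
        (ζ.1 * Circle.exp a, ζ.2 * Circle.exp b) ∈ Y.source ∧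
          Y (ζ.1 * Circle.exp a, ζ.2 * Circle.exp b) = (a, b - s * a) := by
  let α : Circle → Circle → ℝ := fun ζ₀ z => Complex.arg ((ζ₀⁻¹ * z : Circle) : ℂ)
  have hαexp : ∀ (ζ₀ : Circle) (a : ℝ), |a| < Real.pi → α ζ₀ (ζ₀ * Circle.exp a) = a := by
    intro ζ₀ a ha
    simp only [α, inv_mul_cancel_left]
    exact Circle.arg_exp (neg_lt_of_abs_lt ha) (abs_lt.1 ha).2.le
  have hexpα : ∀ ζ₀ z : Circle, ζ₀ * Circle.exp (α ζ₀ z) = z := by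
    intro ζ₀ z
    simp only [α]
    rw [Circle.exp_arg, mul_inv_cancel_left]
  have hslit : ∀ ζ₀ z : Circle, ((ζ₀⁻¹ * z : Circle) : ℂ) ∈ Complex.slitPlane ↔
      |α ζ₀ z| < Real.pi := by
    intro ζ₀ z
    rw [Complex.mem_slitPlane_iff_arg, abs_lt]
    refine ⟨fun h => ⟨Complex.neg_pi_lt_arg _, lt_of_le_of_ne (Complex.arg_le_pi _) h.1⟩,
      fun h => ⟨h.2.ne, Circle.coe_ne_zero _⟩⟩
  have hopen : ∀ ζ₀ : Circle, IsOpen {z : Circle | |α ζ₀ z| < Real.pi} := by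
    intro ζ₀
    have : {z : Circle | |α ζ₀ z| < Real.pi} =
        (fun z : Circle => ((ζ₀⁻¹ * z : Circle) : ℂ)) ⁻¹' Complex.slitPlane := by
      ext z; exact (hslit ζ₀ z).symm
    rw [this]
    exact Complex.isOpen_slitPlane.preimage
      (continuous_subtype_val.comp (continuous_const.mul continuous_id))
  have hsm : ∀ (ζ₀ z : Circle), |α ζ₀ z| < Real.pi → ContMDiffAt (𝓡 1) 𝓘(ℝ, ℝ) ∞ (α ζ₀) z :=
    fun ζ₀ z hz => contMDiffAt_arg_circle ζ₀ ((hslit ζ₀ z).2 hz)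
  refine ⟨
    { toFun := fun z => (α ζ.1 z.1, α ζ.2 z.2 - s * α ζ.1 z.1)
      invFun := fun c => (ζ.1 * Circle.exp c.1, ζ.2 * Circle.exp (c.2 + s * c.1))
      source := {z | |α ζ.1 z.1| < Real.pi ∧ |α ζ.2 z.2| < Real.pi}
      target := {c | |c.1| < Real.pi ∧ |c.2 + s * c.1| < Real.pi}
      map_source' := ?_
      map_target' := ?_
      left_inv' := ?_
      right_inv' := ?_
      open_source := ?_
      open_target := ?_
      contMDiffOn_toFun := ?_
      contMDiffOn_invFun := ?_ }, ?_, ?_, ?_⟩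
  · rintro z ⟨h1, h2⟩
    exact ⟨h1, by simpa using h2⟩
  · rintro c ⟨h1, h2⟩
    refine ⟨?_, ?_⟩
    · simp only [hαexp _ _ h1]; exact h1
    · simp only [hαexp _ _ h2]; exact h2
  · rintro z -
    simp [hexpα]
  · rintro c ⟨h1, h2⟩
    simp only [hαexp _ _ h1, hαexp _ _ h2, add_sub_cancel_right]
  · exact ((hopen ζ.1).preimage continuous_fst).inter ((hopen ζ.2).preimage continuous_snd)
  · exact (isOpen_lt (f := fun c : ℝ × ℝ => |c.1|) (by fun_prop) continuous_const).inter
      (isOpen_lt (f := fun c : ℝ × ℝ => |c.2 + s * c.1|) (by fun_prop) continuous_const)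
  · rintro z ⟨h1, h2⟩
    have e1 : ContMDiffAt ((𝓡 1).prod (𝓡 1)) 𝓘(ℝ, ℝ) ∞
        (fun z : Circle × Circle => α ζ.1 z.1) z := (hsm _ _ h1).comp z contMDiffAt_fst
    have e2 : ContMDiffAt ((𝓡 1).prod (𝓡 1)) 𝓘(ℝ, ℝ) ∞
        (fun z : Circle × Circle => α ζ.2 z.2) z := (hsm _ _ h2).comp z contMDiffAt_snd
    have e3 : ContDiff ℝ ∞ (fun c : ℝ × ℝ => (c.1, c.2 - s * c.1)) := by fun_prop
    exact (e3.contMDiff.contMDiffAt.comp z (e1.prodMk_space e2)).contMDiffWithinAt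
  · have e1 : ContMDiff 𝓘(ℝ, ℝ × ℝ) (𝓡 1) ∞
        (fun c : ℝ × ℝ => ζ.1 * Circle.exp c.1) :=
      contMDiff_mul_left.comp (contMDiff_circleExp.comp contDiff_fst.contMDiff)
    have e0 : ContDiff ℝ ∞ (fun c : ℝ × ℝ => c.2 + s * c.1) := by fun_prop
    have e2 : ContMDiff 𝓘(ℝ, ℝ × ℝ) (𝓡 1) ∞
        (fun c : ℝ × ℝ => ζ.2 * Circle.exp (c.2 + s * c.1)) :=
      contMDiff_mul_left.comp (contMDiff_circleExp.comp e0.contMDiff)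
    exact (e1.prodMk e2).contMDiffOn
  · have h : ∀ ζ₀, α ζ₀ ζ₀ = 0 := fun ζ₀ => by simp [α]
    simp [h, Real.pi_pos]
  · have h : ∀ ζ₀, α ζ₀ ζ₀ = 0 := fun ζ₀ => by simp [α]
    simp [h]
  · intro a b ha hb
    simp [hαexp _ _ ha, hαexp _ _ hb, ha, hb]

/-! ### The weighted flow -/

section WeightedFlow

variable {n : ℕ}

/-- The holomorphic flow `z ↦ (exp (c / w₁) z₁, …, exp (c / wₙ) zₙ)` on `ℂⁿ`, with complex
time `c`. -/
noncomputable def weightedFlow (w : Fin n → ℚ) (c : ℂ) (z : Cn n) : Cn n :=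
  WithLp.toLp 2 fun j => Complex.exp (c * (w j : ℂ)⁻¹) * z j

/-- The generator of the weighted flow at the point `z`. -/
noncomputable def weightedEuler (w : Fin n → ℚ) (z : Cn n) : Cn n :=
  WithLp.toLp 2 fun j => (w j : ℂ)⁻¹ * z j

theorem weightedFlow_zero (w : Fin n → ℚ) (z : Cn n) : weightedFlow w 0 z = z := by
  ext j; simp [weightedFlow]

theorem contDiff_weightedFlow (w : Fin n → ℚ) :
    ContDiff ℂ ω (fun x : ℂ × Cn n => weightedFlow w x.1 x.2) := by
  rw [contDiff_piLp]
  intro j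
  simp only [weightedFlow]
  have h1 : ContDiff ℂ ω (fun x : ℂ × Cn n => x.2 j) :=
    (EuclideanSpace.proj (𝕜 := ℂ) j).contDiff.comp contDiff_snd
  exact ((contDiff_fst.mul contDiff_const).cexp).mul h1

theorem hasFDerivAt_weightedFlow (w : Fin n → ℚ) (z : Cn n) :
    HasFDerivAt (fun x : ℂ × Cn n => weightedFlow w x.1 x.2)
      (((ContinuousLinearMap.fst ℂ ℂ (Cn n)).smulRight (weightedEuler w z)) +
        ContinuousLinearMap.snd ℂ ℂ (Cn n)) (0, z) := by
  rw [← hasFDerivWithinAt_univ, hasFDerivWithinAt_piLp]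
  intro j
  rw [hasFDerivWithinAt_univ]
  have h1 : HasFDerivAt (fun x : ℂ × Cn n => x.2 j)
      ((EuclideanSpace.proj (𝕜 := ℂ) j).comp (ContinuousLinearMap.snd ℂ ℂ (Cn n))) (0, z) :=
    ((EuclideanSpace.proj (𝕜 := ℂ) j).comp (ContinuousLinearMap.snd ℂ ℂ (Cn n))).hasFDerivAt
  have h2 := ((hasFDerivAt_fst (𝕜 := ℂ) (p := ((0 : ℂ), z))).mul_const ((w j : ℂ)⁻¹)).cexp.mul h1
  refine h2.congr_fderiv ?_
  refine ContinuousLinearMap.ext fun v => ?_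
  simp [weightedEuler]
  ring

theorem coeff_X_mul_pderiv (f : MvPolynomial (Fin n) ℂ) (j : Fin n) (m : Fin n →₀ ℕ) :
    MvPolynomial.coeff m (MvPolynomial.X j * MvPolynomial.pderiv j f) =
      (m j : ℂ) * MvPolynomial.coeff m f := by
  induction f using MvPolynomial.induction_on' with
  | monomial u a =>
    rw [MvPolynomial.X_mul_pderiv_monomial, MvPolynomial.coeff_smul, MvPolynomial.coeff_monomial]
    split_ifs with h
    · subst h; simp
    · simp
  | add p q hp hq => rw [map_add, mul_add, MvPolynomial.coeff_add, hp, hq, MvPolynomial.coeff_add,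
      mul_add]

/-- All monomials of a weighted homogeneous polynomial have weighted degree `1`. -/
theorem HasWeights.sum_eq_one {f : MvPolynomial (Fin n) ℂ} {w : Fin n → ℚ} (hf : HasWeights f w)
    {m : Fin n →₀ ℕ} (hm : m ∈ f.support) : ∑ j, (m j : ℂ) * (w j : ℂ)⁻¹ = 1 := by
  have h := congrArg (MvPolynomial.coeff m) hf.2
  rw [MvPolynomial.coeff_sum] at h
  simp only [mul_assoc, MvPolynomial.coeff_C_mul, coeff_X_mul_pderiv] at h
  have h0 := MvPolynomial.mem_support_iff.1 hm
  refine mul_right_cancel₀ h0 ?_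
  rw [one_mul, Finset.sum_mul]
  refine Eq.trans (Finset.sum_congr rfl fun j _ => ?_) h
  ring

theorem HasWeights.polyFun_weightedFlow {f : MvPolynomial (Fin n) ℂ} {w : Fin n → ℚ}
    (hf : HasWeights f w) (c : ℂ) (z : Cn n) :
    polyFun f (weightedFlow w c z) = Complex.exp c * polyFun f z := by
  simp only [polyFun, MvPolynomial.eval_eq', Finset.mul_sum]
  refine Finset.sum_congr rfl fun m hm => ?_
  have h1 : ∏ j, Complex.exp (c * (w j : ℂ)⁻¹) ^ m j = Complex.exp c := by
    simp only [← Complex.exp_nat_mul]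
    rw [← Complex.exp_sum]
    congr 1
    refine Eq.trans ?_ ((congrArg (c * ·) (hf.sum_eq_one hm)).trans (mul_one c))
    rw [Finset.mul_sum]
    refine Finset.sum_congr rfl fun j _ => ?_
    ring
  simp only [weightedFlow, mul_pow, Finset.prod_mul_distrib, h1]
  ring

/-- Scaling the weights by `s` amounts to rescaling the time of the flow. -/
theorem weightedFlow_mul {w w' : Fin n → ℚ} {s : ℚ} (hs : s ≠ 0) (h : ∀ j, w' j = s * w j)
    (c : ℂ) (z : Cn n) : weightedFlow w' (s * c) z = weightedFlow w c z := by
  have hs' : (s : ℂ) ≠ 0 := by exact_mod_cast hs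
  ext j
  simp only [weightedFlow, h, Rat.cast_mul, mul_inv]
  congr 2
  field_simp

/-- Along the flow, a branch of the logarithm of an eigenfunction of the flow grows linearly. -/
theorem IsLogBranchAt.apply_weightedFlow {f : MvPolynomial (Fin n) ℂ} {w : Fin n → ℚ}
    {L : Cn n → ℂ} {p : Cn n} (hL : IsLogBranchAt f L p) {κ : ℂ}
    (hf : ∀ c z, polyFun f (weightedFlow w c z) = Complex.exp (κ * c) * polyFun f z) :
    ∀ᶠ x : ℂ × Cn n in 𝓝 (0, p), L (weightedFlow w x.1 x.2) = L x.2 + κ * x.1 := by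
  have hfl : Filter.Tendsto (fun x : ℂ × Cn n => weightedFlow w x.1 x.2) (𝓝 (0, p)) (𝓝 p) := by
    have := (contDiff_weightedFlow w).continuous.tendsto (0, p)
    rwa [weightedFlow_zero] at this
  have hsnd : Filter.Tendsto (fun x : ℂ × Cn n => x.2) (𝓝 (0, p)) (𝓝 p) :=
    continuous_snd.tendsto _
  have hfst : Filter.Tendsto (fun x : ℂ × Cn n => κ * x.1) (𝓝 (0, p)) (𝓝 0) := by
    have : Continuous fun x : ℂ × Cn n => κ * x.1 := by fun_prop
    simpa using this.tendsto (0, p)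
  have hd : Filter.Tendsto (fun x : ℂ × Cn n => L (weightedFlow w x.1 x.2) - L x.2 - κ * x.1)
      (𝓝 (0, p)) (𝓝 0) := by
    have := ((hL.1.continuousAt.tendsto.comp hfl).sub (hL.1.continuousAt.tendsto.comp hsnd)).sub
      hfst
    simpa using this
  have hsmall : ∀ᶠ x : ℂ × Cn n in 𝓝 (0, p),
      ‖L (weightedFlow w x.1 x.2) - L x.2 - κ * x.1‖ < 2 * Real.pi := by
    have := hd.norm
    rw [norm_zero] at this
    exact this.eventually_lt_const Real.two_pi_pos
  filter_upwards [hsmall, hfl.eventually hL.2, hsnd.eventually hL.2] with x h1 h2 h3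
  have h4 : Complex.exp (L (weightedFlow w x.1 x.2) - L x.2 - κ * x.1) = 1 := by
    rw [Complex.exp_sub, Complex.exp_sub, h2, hf, ← h3]
    field_simp
  -- the discrepancy is a multiple of `2 π i`, and small near `(0, p)`
  obtain ⟨k, hk⟩ := Complex.exp_eq_one_iff.1 h4
  rw [hk] at h1
  have h5 : k = 0 := by
    by_contra hk0
    have h6 : (1 : ℝ) ≤ |(k : ℝ)| := by exact_mod_cast Int.one_le_abs hk0
    simp only [norm_mul, Complex.norm_intCast, Complex.norm_ofNat, Complex.norm_real,
      Complex.norm_I, mul_one, Real.norm_eq_abs, abs_of_pos Real.pi_pos] at h1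
    nlinarith [Real.pi_pos]
  rw [h5] at hk
  simp only [Int.cast_zero, zero_mul] at hk
  linear_combination hk

/-- The generator of the flow points out of the sphere, with no component along `i p`. -/
theorem re_inner_weightedEuler_pos {w : Fin n → ℚ} (hw : ∀ j, 0 < w j) {p : Cn n} (hp : p ≠ 0) :
    0 < (inner ℂ p (weightedEuler w p)).re ∧ (inner ℂ p (weightedEuler w p)).im = 0 := by
  have h1 : inner ℂ p (weightedEuler w p) = ((∑ j, ((w j : ℝ))⁻¹ * ‖p j‖ ^ 2 : ℝ) : ℂ) := by
    rw [PiLp.inner_apply, Complex.ofReal_sum]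
    refine Finset.sum_congr rfl fun j _ => ?_
    simp only [weightedEuler, RCLike.inner_apply]
    push_cast
    rw [mul_assoc, Complex.mul_conj, Complex.normSq_eq_norm_sq]
    push_cast
    rfl
  rw [h1, Complex.ofReal_re, Complex.ofReal_im]
  refine ⟨?_, rfl⟩
  obtain ⟨j, hj⟩ : ∃ j, p j ≠ 0 := by
    by_contra! h
    exact hp (by ext j; simpa using h j)
  have hw' : ∀ j, (0 : ℝ) < (w j : ℝ)⁻¹ := fun j => inv_pos.2 (by exact_mod_cast hw j)
  refine Finset.sum_pos' (fun i _ => mul_nonneg (hw' i).le (by positivity))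
    ⟨j, Finset.mem_univ _, ?_⟩
  exact mul_pos (hw' j) (by positivity)

/-- The phase of `exp l` is `exp (i Im l)`. -/
theorem unitPhase_eq_mul_exp {a b l m : ℂ} (ha : a ≠ 0) (hb : b ≠ 0) (hl : Complex.exp l = a)
    (hm : Complex.exp m = b) : unitPhase b hb = unitPhase a ha * Circle.exp (m.im - l.im) := by
  have key : ∀ x : ℂ, Complex.exp x / (‖Complex.exp x‖ : ℂ) = Complex.exp (x.im * Complex.I) := by
    intro x
    rw [Complex.norm_exp, Complex.ofReal_exp, ← Complex.exp_sub]
    congr 1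
    apply Complex.ext <;> simp
  apply Subtype.ext
  change b / (‖b‖ : ℂ) = a / (‖a‖ : ℂ) * (Circle.exp (m.im - l.im) : ℂ)
  rw [← hl, ← hm, key, key, Circle.coe_exp, ← Complex.exp_add]
  congr 1
  push_cast
  ring

end WeightedFlow

/-! ### The Milnor fibration product map in coordinates -/

section WeightedLog

variable {n : ℕ} {f : MvPolynomial (Fin n) ℂ} {w : Fin n → ℚ} {L : Cn n → ℂ} {p : Cn n} {κ : ℂ}

/-- The infinitesimal form of linear growth along the weighted flow. -/
theorem fderiv_weightedEuler (hL : DifferentiableAt ℂ L p)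
    (h : ∀ᶠ x : ℂ × Cn n in 𝓝 (0, p), L (weightedFlow w x.1 x.2) = L x.2 + κ * x.1) :
    fderiv ℂ L p (weightedEuler w p) = κ := by
  have h1 : HasFDerivAt L (fderiv ℂ L p)
      ((fun x : ℂ × Cn n => weightedFlow w x.1 x.2) (0, p)) := by
    simp only [weightedFlow_zero]
    exact hL.hasFDerivAt
  have h2 := h1.comp (0, p) (hasFDerivAt_weightedFlow w p)
  have h3 : HasFDerivAt (fun x : ℂ × Cn n => L x.2 + κ * x.1) _ (0, p) :=
    ((show HasFDerivAt L (fderiv ℂ L p) ((0 : ℂ), p).2 from hL.hasFDerivAt).comp (0, p)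
      hasFDerivAt_snd).add ((hasFDerivAt_fst (𝕜 := ℂ) (p := ((0 : ℂ), p))).const_mul κ)
  have h4 := DFunLike.congr_fun (h2.unique (h3.congr_of_eventuallyEq h)) ((1 : ℂ), (0 : Cn n))
  simpa using h4

/-- The vector `i grad L` is the real gradient of `Im L`. -/
theorem inner_I_smul_complexGrad (L : Cn n → ℂ) (p v : Cn n) :
    (inner ℂ (Complex.I • complexGrad L p) v).re = (fderiv ℂ L p v).im := by
  have h1 : inner ℂ (complexGrad L p) v = fderiv ℂ L p v := by
    have hv : v = ∑ j, v j • EuclideanSpace.single j (1 : ℂ) := by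
      ext i
      simp [Finset.sum_apply, Pi.single_apply]
    conv_rhs => rw [hv, map_sum]
    rw [PiLp.inner_apply]
    refine Finset.sum_congr rfl fun j _ => ?_
    simp [complexGrad, partialZ, RCLike.inner_apply]
  rw [inner_smul_left, h1]
  simp

end WeightedLog

section Fold

variable {n : ℕ} [n.AtLeastTwo] {ε : ℝ} [Fact (0 < ε)] {f g : MvPolynomial (Fin n) ℂ}
  {logf logg : Cn n → ℂ}

omit [n.AtLeastTwo] in
theorem val_ne_zero (p : linkComplement f g ε) : p.1.val ≠ 0 := by
  rw [← norm_pos_iff, CSphere.norm_val]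
  exact Fact.out

omit [n.AtLeastTwo] [Fact (0 < ε)] in
/-- In sheared angular coordinates on the torus, the Milnor fibration product map is
`(Im log f, Im (log g - s log f))` up to a constant. -/
theorem exists_milnorProductMap_coordinates (s : ℚ) (p : linkComplement f g ε)
    (hlogf : IsLogBranchAt f logf p.1.val) (hlogg : IsLogBranchAt g logg p.1.val) :
    ∃ Y : PartialDiffeomorph ((𝓡 1).prod (𝓡 1)) 𝓘(ℝ, ℝ × ℝ) (Circle × Circle) (ℝ × ℝ) ∞,
      milnorProductMap f g ε p ∈ Y.source ∧ Y (milnorProductMap f g ε p) = 0 ∧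
      ∀ᶠ q in 𝓝 p, milnorProductMap f g ε q ∈ Y.source ∧ Y (milnorProductMap f g ε q) =
        ((logf q.1.val).im - (logf p.1.val).im,
          (logg q.1.val - s * logf q.1.val).im - (logg p.1.val - s * logf p.1.val).im) := by
  obtain ⟨Y, hY1, hY2, hY3⟩ := exists_torus_coordinates (s : ℝ) (milnorProductMap f g ε p)
  refine ⟨Y, hY1, hY2, ?_⟩
  have hval : Filter.Tendsto (fun q : linkComplement f g ε => q.1.val) (𝓝 p) (𝓝 p.1.val) :=
    (CSphere.continuous_val.comp continuous_subtype_val).tendsto p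
  have hsmall : ∀ L : Cn n → ℂ, ContinuousAt L p.1.val →
      ∀ᶠ q : linkComplement f g ε in 𝓝 p, |(L q.1.val).im - (L p.1.val).im| < Real.pi := by
    intro L hL
    have h1 := ((Complex.continuous_im.tendsto _).comp (hL.tendsto.comp hval)).sub_const
      ((L p.1.val).im)
    rw [sub_self] at h1
    have h2 := h1.abs
    rw [abs_zero] at h2
    exact h2.eventually_lt_const Real.pi_pos
  filter_upwards [hval.eventually hlogf.2, hval.eventually hlogg.2,
    hsmall logf hlogf.1.continuousAt, hsmall logg hlogg.1.continuousAt] with q h1 h2 h3 h4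
  have e1 : milnorProductMap f g ε q =
      ((milnorProductMap f g ε p).1 * Circle.exp ((logf q.1.val).im - (logf p.1.val).im),
        (milnorProductMap f g ε p).2 * Circle.exp ((logg q.1.val).im - (logg p.1.val).im)) :=
    Prod.ext (unitPhase_eq_mul_exp (left_ne_zero_of_mul p.2) (left_ne_zero_of_mul q.2)
      hlogf.2.self_of_nhds h1)
      (unitPhase_eq_mul_exp (right_ne_zero_of_mul p.2) (right_ne_zero_of_mul q.2)
        hlogg.2.self_of_nhds h2)
  obtain ⟨h5, h6⟩ := hY3 _ _ h3 h4
  rw [e1]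
  refine ⟨h5, h6.trans (Prod.ext rfl ?_)⟩
  simp only [Complex.sub_im, Complex.mul_im, Complex.ratCast_re, Complex.ratCast_im]
  ring

/-- At a singular point the differential of the map in coordinates, restricted to the tangent space
of the sphere, is not surjective. -/
theorem not_surjective_of_isSingularPoint {p : linkComplement f g ε}
    (hp : IsSingularPoint (𝓡 (2 * n - 1)) ((𝓡 1).prod (𝓡 1)) (milnorProductMap f g ε) p)
    (Y : PartialDiffeomorph ((𝓡 1).prod (𝓡 1)) 𝓘(ℝ, ℝ × ℝ) (Circle × Circle) (ℝ × ℝ) ∞)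
    (hY : milnorProductMap f g ε p ∈ Y.source) {T : Cn n → ℝ × ℝ}
    {T' : Cn n →L[ℝ] ℝ × ℝ} (hT : HasFDerivAt T T' p.1.val)
    (hYT : ∀ᶠ q in 𝓝 p, milnorProductMap f g ε q ∈ Y.source ∧
      Y (milnorProductMap f g ε q) = T q.1.val) :
    ¬ ∀ y, ∃ v, (inner ℂ p.1.val v).re = 0 ∧ T' v = y := by
  intro hsurj
  set F := milnorProductMap f g ε
  set e := chartAt (EuclideanSpace ℝ (Fin (2 * n - 1))) p
  have hep : e.symm (e p) = p := e.left_inv (mem_chart_source _ p)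
  have hTp : T p.1.val = Y (F p) := hYT.self_of_nhds.2.symm
  have hYinv : MDifferentiableAt 𝓘(ℝ, ℝ × ℝ) ((𝓡 1).prod (𝓡 1)) Y.invFun (T p.1.val) := by
    rw [hTp]
    exact (Y.contMDiffOn_invFun.contMDiffAt (Y.open_target.mem_nhds
      (Y.map_source hY))).mdifferentiableAt (by simp)
  have hι : MDifferentiableAt (𝓡 (2 * n - 1)) 𝓘(ℝ, Cn n)
      (fun q : linkComplement f g ε => q.1.val) p :=
    contMDiff_linkComplement_val.mdifferentiableAt (by simp)
  have hF : MDifferentiableAt (𝓡 (2 * n - 1)) ((𝓡 1).prod (𝓡 1)) F p := by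
    have h1 : MDifferentiableAt (𝓡 (2 * n - 1)) 𝓘(ℝ, ℝ × ℝ)
        (T ∘ fun q : linkComplement f g ε => q.1.val) p :=
      MDifferentiableAt.comp p hT.differentiableAt.mdifferentiableAt hι
    have h2 := MDifferentiableAt.comp p (g := Y.invFun)
      (f := T ∘ fun q : linkComplement f g ε => q.1.val) hYinv h1
    refine h2.congr_of_eventuallyEq ?_
    filter_upwards [hYT] with q hq
    simp only [Function.comp_apply]
    rw [← hq.2]
    exact (Y.left_inv hq.1).symm
  have hF' : MDifferentiableAt (𝓡 (2 * n - 1)) ((𝓡 1).prod (𝓡 1)) F (e.symm (e p)) := by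
    rw [hep]; exact hF
  have hp' : IsSingularPoint (𝓡 (2 * n - 1)) ((𝓡 1).prod (𝓡 1)) F (e.symm (e p)) := by
    rw [hep]; exact hp
  have he : MDifferentiableAt (𝓡 (2 * n - 1)) (𝓡 (2 * n - 1)) e.symm (e p) :=
    ((contMDiffOn_chart_symm (I := 𝓡 (2 * n - 1)) (n := ω) (x := p)).contMDiffAt
      (e.open_target.mem_nhds (mem_chart_target _ p))).mdifferentiableAt (by simp)
  have hYd : MDifferentiableAt ((𝓡 1).prod (𝓡 1)) 𝓘(ℝ, ℝ × ℝ) Y (F (e.symm (e p))) := by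
    rw [hep]
    exact Y.mdifferentiableAt (by simp) hY
  have hcomp := (hYd.hasMFDerivAt.comp _ hF'.hasMFDerivAt).comp (e p) he.hasMFDerivAt
  have hcomp' := hasMFDerivAt_iff_hasFDerivAt.1 hcomp
  have hTκ : HasFDerivAt (T ∘ linkParam p) (T'.comp (fderiv ℝ (linkParam p) (e p))) (e p) := by
    refine HasFDerivAt.comp (e p) ?_ (analyticAt_linkParam p).differentiableAt.hasFDerivAt
    rw [linkParam_chartAt]; exact hT
  have heq : ((Y ∘ F) ∘ e.symm) =ᶠ[𝓝 (e p)] T ∘ linkParam p := by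
    have h1 := e.continuousAt_symm (mem_chart_target _ p)
    rw [ContinuousAt, hep] at h1
    filter_upwards [h1.eventually hYT] with y hy using hy.2
  have huniq := (hTκ.congr_of_eventuallyEq heq).unique hcomp'
  have hsurj2 : Function.Surjective (mfderiv ((𝓡 1).prod (𝓡 1)) 𝓘(ℝ, ℝ × ℝ) Y (F (e.symm (e p))) ∘
      mfderiv (𝓡 (2 * n - 1)) ((𝓡 1).prod (𝓡 1)) F (e.symm (e p))) := by
    intro y
    obtain ⟨v, hv1, hv2⟩ := hsurj y
    obtain ⟨u, hu⟩ := exists_fderiv_linkParam_eq p hv1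
    refine ⟨mfderiv (𝓡 (2 * n - 1)) (𝓡 (2 * n - 1)) e.symm (e p) u, ?_⟩
    have h1 := DFunLike.congr_fun huniq u
    refine Eq.trans h1.symm ?_
    exact (congrArg T' hu).trans hv2
  let D : EuclideanSpace ℝ (Fin (2 * n - 1)) →ₗ[ℝ]
      EuclideanSpace ℝ (Fin 1) × EuclideanSpace ℝ (Fin 1) :=
    (mfderiv (𝓡 (2 * n - 1)) ((𝓡 1).prod (𝓡 1)) F (e.symm (e p))).toLinearMap
  let DY : EuclideanSpace ℝ (Fin 1) × EuclideanSpace ℝ (Fin 1) →ₗ[ℝ] ℝ × ℝ :=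
    (mfderiv ((𝓡 1).prod (𝓡 1)) 𝓘(ℝ, ℝ × ℝ) Y (F (e.symm (e p)))).toLinearMap
  have hrank : Module.finrank ℝ (LinearMap.range D) < 2 := by
    have h1 : Module.finrank ℝ (LinearMap.range D) < min _ _ := hp'
    refine h1.trans_le ((min_le_right _ _).trans ?_)
    rw [Module.finrank_prod, finrank_euclideanSpace_fin]
  have htop : LinearMap.range (DY.comp (LinearMap.range D).subtype) = ⊤ := by
    rw [LinearMap.range_eq_top]
    intro y
    obtain ⟨u, hu⟩ := hsurj2 y
    exact ⟨⟨D u, u, rfl⟩, hu⟩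
  have h1 := LinearMap.finrank_range_le (DY.comp (LinearMap.range D).subtype)
  rw [htop, finrank_top, Module.finrank_prod, Module.finrank_self] at h1
  omega

end Fold

/-! ### The slice transverse to the flow, and the Hessian -/

section Slice

variable {n : ℕ} {W : Type*} [NormedAddCommGroup W] [InnerProductSpace ℝ W]
  [FiniteDimensional ℝ W] {w : Fin n → ℚ} {p : Cn n} {L G : Cn n → ℂ}

/-- The real affine slice `p + V W`, moved by the weighted flow, sweeps out a neighbourhood of `p`.
The position `(F z).2` of `z` in the slice, together with `Im L z`, is a local coordinate system on
the sphere through `p`, and a function `G` invariant under the flow only depends on this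
position. -/
theorem exists_slice_coordinates [n.AtLeastTwo] (hw : ∀ j, 0 < w j) (hp : p ≠ 0)
    (hL : AnalyticAt ℂ L p)
    (hLflow : ∀ᶠ x : ℂ × Cn n in 𝓝 (0, p), L (weightedFlow w x.1 x.2) = L x.2 + x.1)
    (hGflow : ∀ᶠ x : ℂ × Cn n in 𝓝 (0, p), G (weightedFlow w x.1 x.2) = G x.2)
    {V : W →L[ℝ] Cn n} (hVi : Function.Injective V)
    (hV : ∀ u, (inner ℂ p (V u)).re = 0 ∧ (fderiv ℂ L p (V u)).im = 0)
    (hdim : Module.finrank ℝ W = 2 * n - 2) :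
    ∃ F : Cn n → ℝ × W, AnalyticAt ℝ F p ∧ F p = 0 ∧
      (∀ v, (inner ℂ p v).re = 0 → fderiv ℝ F p v = 0 → v = 0) ∧
      ∀ᶠ z in 𝓝 p, (F z).1 = (L z).im - (L p).im ∧ G z = G (p + V (F z).2) := by
  have hE : fderiv ℂ L p (weightedEuler w p) = 1 :=
    fderiv_weightedEuler hL.differentiableAt (hLflow.mono fun x hx => by rw [hx, one_mul])
  obtain ⟨hpos, him⟩ := re_inner_weightedEuler_pos hw hp
  set E := weightedEuler w p
  -- a multiple of the Euler field tangent to the slice, the sphere and the fibre of `Im L` vanishes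
  have hEzero : ∀ (c : ℂ) (v : Cn n), (inner ℂ p v).re = 0 → (fderiv ℂ L p v).im = 0 →
      (inner ℂ p (c • E + v)).re = 0 → (fderiv ℂ L p (c • E + v)).im = 0 → c = 0 := by
    intro c v h1 h2 h3 h4
    rw [inner_add_right, inner_smul_right, Complex.add_re, h1, Complex.mul_re, him] at h3
    rw [map_add, map_smul, hE, Complex.add_im, h2] at h4
    have h5 : c.re = 0 := by
      have : c.re * (inner ℂ p E).re = 0 := by linarith
      exact (mul_eq_zero.1 this).resolve_right hpos.ne'
    exact Complex.ext h5 (by simpa using h4)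
  let S : ℂ × W → ℂ × Cn n := fun x => (x.1, p + V x.2)
  let Ψ : ℂ × W → Cn n := fun x => weightedFlow w x.1 (p + V x.2)
  have hS0 : S 0 = (0, p) := by simp [S]
  have hScont : ContDiff ℝ ω S := contDiff_fst.prodMk (contDiff_const.add (V.contDiff.comp
    contDiff_snd))
  have hΨ : AnalyticAt ℝ Ψ 0 :=
    (((contDiff_weightedFlow w).restrict_scalars ℝ).comp hScont).contDiffAt.analyticAt
  have hΨ0 : Ψ 0 = p := by simp [Ψ, weightedFlow_zero]
  let D : ℂ × W →L[ℝ] Cn n := ((ContinuousLinearMap.fst ℝ ℂ W).smulRight E) +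
    V.comp (ContinuousLinearMap.snd ℝ ℂ W)
  have hΨD : HasFDerivAt Ψ D 0 := by
    have h1 := (hasFDerivAt_weightedFlow w p).restrictScalars ℝ
    rw [← hS0] at h1
    have h2 : HasFDerivAt S ((ContinuousLinearMap.fst ℝ ℂ W).prod
        (V.comp (ContinuousLinearMap.snd ℝ ℂ W))) 0 :=
      hasFDerivAt_fst.prodMk ((V.hasFDerivAt.comp (0 : ℂ × W) hasFDerivAt_snd).const_add p)
    refine (h1.comp (0 : ℂ × W) h2).congr_fderiv ?_
    exact ContinuousLinearMap.ext fun v => rfl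
  have hDapp : ∀ x : ℂ × W, D x = x.1 • E + V x.2 := fun x => rfl
  have hDi : Function.Injective D := by
    rw [injective_iff_map_eq_zero]
    rintro ⟨c, u⟩ h
    rw [hDapp] at h
    have h1 : c = 0 := hEzero c (V u) (hV u).1 (hV u).2 (by rw [h]; simp) (by rw [h]; simp)
    subst h1
    have h2 : V u = 0 := by simpa using h
    rw [(map_eq_zero_iff V hVi).1 h2]
    rfl
  have hrank : Module.finrank ℝ (ℂ × W) = Module.finrank ℝ (Cn n) := by
    have h3 : Module.finrank ℝ (Cn n) = (2 * n - 1) + 1 := Fact.out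
    have h4 : 2 ≤ n := Nat.AtLeastTwo.prop
    rw [Module.finrank_prod, Complex.finrank_real_complex, hdim, h3]
    omega
  let D' : (ℂ × W) ≃L[ℝ] Cn n :=
    (LinearEquiv.ofInjectiveOfFinrankEq D.toLinearMap hDi hrank).toContinuousLinearEquiv
  have hΨD' : HasFDerivAt Ψ (D' : ℂ × W →L[ℝ] Cn n) 0 :=
    hΨD.congr_fderiv (ContinuousLinearMap.ext fun v => rfl)
  obtain ⟨Γ, hΓa, hΓ0, hΓ', hΓr⟩ := hΨ.exists_localInverse hΨD'
  rw [hΨ0] at hΓa hΓ0 hΓ' hΓr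
  have hLim : AnalyticAt ℝ (fun z => (L z).im - (L p).im) p :=
    ((Complex.imCLM.analyticAt _).comp (hL.restrictScalars (𝕜 := ℝ))).sub analyticAt_const
  have hLimD : HasFDerivAt (fun z => (L z).im - (L p).im)
      (Complex.imCLM.comp ((fderiv ℂ L p).restrictScalars ℝ)) p :=
    (Complex.imCLM.hasFDerivAt.comp p
      (hL.differentiableAt.hasFDerivAt.restrictScalars ℝ)).sub_const _
  have hFa : AnalyticAt ℝ (fun z => ((L z).im - (L p).im, (Γ z).2)) p :=
    hLim.prod (analyticAt_snd.comp hΓa)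
  have hFD := hLimD.prodMk hΓ'.snd
  refine ⟨fun z => ((L z).im - (L p).im, (Γ z).2), hFa, ?_, ?_, ?_⟩
  · simp [hΓ0]
  · intro v hv1 hv2
    rw [hFD.fderiv] at hv2
    have h1 : (fderiv ℂ L p v).im = 0 := congrArg Prod.fst hv2
    have h2 : (D'.symm v).2 = 0 := congrArg Prod.snd hv2
    have h3 : v = (D'.symm v).1 • E := by
      have h4 : D (D'.symm v) = v := D'.apply_symm_apply v
      rw [hDapp, h2, map_zero, add_zero] at h4
      exact h4.symm
    have h5 : (D'.symm v).1 = 0 := by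
      refine hEzero _ 0 (by simp) (by simp) ?_ ?_
      · rw [add_zero, ← h3]; exact hv1
      · rw [add_zero, ← h3]; exact h1
    rw [h3, h5, zero_smul]
  · have h1 : Filter.Tendsto (fun z => S (Γ z)) (𝓝 p) (𝓝 (0, p)) := by
      have h2 := hΓa.continuousAt.tendsto
      rw [hΓ0] at h2
      have h3 := hScont.continuous.tendsto 0
      rw [hS0] at h3
      exact h3.comp h2
    filter_upwards [hΓr, h1.eventually hGflow] with z h2 h3
    exact ⟨rfl, (congrArg G h2).symm.trans h3⟩

end Slice

theorem finrank_realOrthogonal {n : ℕ} [n.AtLeastTwo] {a b : Cn n}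
    (h : ∀ y : ℝ × ℝ, ∃ v, (inner ℂ a v).re = y.1 ∧ (inner ℂ b v).re = y.2) :
    Module.finrank ℝ (realOrthogonal a b) = 2 * n - 2 := by
  let φ : Cn n →ₗ[ℝ] ℝ × ℝ :=
    (Complex.reLm.comp ((innerSL ℂ a).toLinearMap.restrictScalars ℝ)).prod
      (Complex.reLm.comp ((innerSL ℂ b).toLinearMap.restrictScalars ℝ))
  have h1 : φ.range = ⊤ := by
    rw [LinearMap.range_eq_top]
    intro y
    obtain ⟨v, h1, h2⟩ := h y
    exact ⟨v, Prod.ext h1 h2⟩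
  have h2 : φ.ker = realOrthogonal a b := by
    ext v
    exact Prod.ext_iff
  have h3 := φ.finrank_range_add_finrank_ker
  have h4 : Module.finrank ℝ (Cn n) = (2 * n - 1) + 1 := Fact.out
  have h5 : 2 ≤ n := Nat.AtLeastTwo.prop
  rw [h1, h2, finrank_top, Module.finrank_prod, Module.finrank_self, h4] at h3
  omega

section Hessian

variable {n : ℕ} {W : Type*} [NormedAddCommGroup W] [NormedSpace ℝ W] {p : Cn n} {h : Cn n → ℂ}
  {V : W →L[ℝ] Cn n}

theorem hasFDerivAt_re_comp_affine {u : W} (hh : DifferentiableAt ℂ h (p + V u)) (c : ℝ) :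
    HasFDerivAt (fun u => (h (p + V u)).re - c)
      (Complex.reCLM.comp (((fderiv ℂ h (p + V u)).restrictScalars ℝ).comp V)) u :=
  (Complex.reCLM.hasFDerivAt.comp u ((hh.hasFDerivAt.restrictScalars ℝ).comp u
    (V.hasFDerivAt.const_add p))).sub_const c

/-- The real Hessian of the real part of a holomorphic function along a real affine subspace. -/
theorem fderiv_fderiv_re_comp_affine (hh : AnalyticAt ℂ h p) (c : ℝ) (u v : W) :
    fderiv ℝ (fderiv ℝ fun u => (h (p + V u)).re - c) 0 u v =
      (fderiv ℂ (fderiv ℂ h) p (V u) (V v)).re := by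
  have hline : Filter.Tendsto (fun u => p + V u) (𝓝 0) (𝓝 p) := by
    have : Continuous fun u => p + V u := by fun_prop
    simpa using this.tendsto 0
  have h1 : ∀ᶠ x in 𝓝 (0 : W), fderiv ℝ (fun u => (h (p + V u)).re - c) x =
      Complex.reCLM.comp (((fderiv ℂ h (p + V x)).restrictScalars ℝ).comp V) := by
    filter_upwards [hline.eventually hh.eventually_analyticAt] with x hx
    exact (hasFDerivAt_re_comp_affine hx.differentiableAt c).fderiv
  have hQ : AnalyticAt ℝ (fun u => (h (p + V u)).re - c) 0 := by
    have h0 : AnalyticAt ℝ h (p + V 0) := by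
      rw [map_zero, add_zero]; exact hh.restrictScalars
    have h2 : AnalyticAt ℝ (fun u => p + V u) 0 := analyticAt_const.add (V.analyticAt 0)
    exact ((Complex.reCLM.analyticAt _).comp
      (AnalyticAt.fun_comp (f := fun u => p + V u) h0 h2)).sub analyticAt_const
  have hd := hQ.fderiv.differentiableAt.hasFDerivAt.clm_apply (hasFDerivAt_const v (0 : W))
  have h2 : ∀ᶠ x in 𝓝 (0 : W), fderiv ℝ (fun u => (h (p + V u)).re - c) x v =
      (fderiv ℂ h (p + V x) (V v)).re := h1.mono fun x hx => by rw [hx]; rfl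
  have h3 : HasFDerivAt (fun z => fderiv ℂ h z (V v)) ((fderiv ℂ (fderiv ℂ h) p).flip (V v))
      (p + V 0) := by
    rw [map_zero, add_zero]
    refine (hh.fderiv.differentiableAt.hasFDerivAt.clm_apply
      (hasFDerivAt_const (V v) p)).congr_fderiv ?_
    ext z
    simp
  have h4 : HasFDerivAt (fun x => (fderiv ℂ h (p + V x) (V v)).re)
      (Complex.reCLM.comp ((((fderiv ℂ (fderiv ℂ h) p).flip (V v)).restrictScalars ℝ).comp V)) 0 :=
    Complex.reCLM.hasFDerivAt.comp (0 : W) (HasFDerivAt.comp (0 : W)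
      (g := fun z => fderiv ℂ h z (V v)) (h3.restrictScalars ℝ) (V.hasFDerivAt.const_add p))
  have h5 := DFunLike.congr_fun (hd.unique (h4.congr_of_eventuallyEq h2)) u
  simpa using h5

theorem fderiv_fderiv_eq_sum_complexHess (hh : AnalyticAt ℂ h p) (u v : Cn n) :
    fderiv ℂ (fderiv ℂ h) p u v = ∑ j, ∑ k, u j * complexHess h p j k * v k := by
  have hb : ∀ v : Cn n, v = ∑ j, v j • EuclideanSpace.single j (1 : ℂ) := by
    intro v
    ext i
    simp [Finset.sum_apply, Pi.single_apply]
  have h1 : ∀ j k, complexHess h p j k = fderiv ℂ (fderiv ℂ h) p (EuclideanSpace.single j 1)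
      (EuclideanSpace.single k 1) := by
    intro j k
    simp only [complexHess, Matrix.of_apply]
    have h2 := (hh.fderiv.differentiableAt.hasFDerivAt.clm_apply
      (hasFDerivAt_const (EuclideanSpace.single k (1 : ℂ)) p)).fderiv
    have h3 := DFunLike.congr_fun h2 (EuclideanSpace.single j 1)
    exact h3.trans (by simp)
  conv_lhs => rw [hb u, hb v]
  simp only [map_sum, map_smul, sum_apply, smul_apply, smul_eq_mul,
    Finset.mul_sum]
  rw [Finset.sum_comm]
  refine Finset.sum_congr rfl fun j _ => Finset.sum_congr rfl fun k _ => ?_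
  rw [h1]
  ring

end Hessian

/-! ### The fold criterion -/

/-- A matrix is invertible if and only if the bilinear form it represents is nondegenerate. -/
theorem det_ne_zero_iff_forall_apply_eq_zero {m : ℕ}
    (b : EuclideanSpace ℝ (Fin m) →L[ℝ] EuclideanSpace ℝ (Fin m) →L[ℝ] ℝ)
    (A : Matrix (Fin m) (Fin m) ℝ)
    (hA : ∀ i j, b (EuclideanSpace.single i 1) (EuclideanSpace.single j 1) = A i j) :
    A.det ≠ 0 ↔ ∀ u, (∀ v, b u v = 0) → u = 0 := by
  have hsum : ∀ v : EuclideanSpace ℝ (Fin m),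
      v = ∑ j, v j • EuclideanSpace.single j (1 : ℝ) := by
    intro v
    ext i
    simp [Finset.sum_apply, Pi.single_apply]
  have h1 : ∀ (u : EuclideanSpace ℝ (Fin m)) j,
      b u (EuclideanSpace.single j 1) = Matrix.vecMul u A j := by
    intro u j
    conv_lhs => rw [hsum u]
    simp [map_sum, sum_apply, Matrix.vecMul, dotProduct, hA]
  have h2 : ∀ u : EuclideanSpace ℝ (Fin m), (∀ v, b u v = 0) ↔ Matrix.vecMul u A = 0 := by
    intro u
    constructor
    · intro h
      funext j
      rw [← h1, h]; rfl
    · intro h v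
      rw [hsum v, map_sum]
      refine Finset.sum_eq_zero fun j _ => ?_
      rw [map_smul, h1, h]
      simp
  rw [Ne, ← Matrix.exists_vecMul_eq_zero_iff]
  push Not
  constructor
  · intro h u hu
    by_contra hne
    refine h u (fun h0 => hne ?_) ((h2 u).1 hu)
    ext j
    exact congrFun h0 j
  · intro h v hv hv0
    have := h (WithLp.toLp 2 v) ((h2 _).2 hv0)
    exact hv (by simpa using congrArg WithLp.ofLp this)

/-- At a singular point of the Milnor fibration product map, a holomorphic function `G` which is
constant along the Euler direction `E` and whose imaginary part is, with `Im L`, a coordinate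
expression of the map, has a critical point. Being singular makes `Im dG` vanish on the tangent
space of the sphere, since `i E` is tangent and only moves `Im L`; and `ℂⁿ` is spanned over `ℝ` by
this tangent space and `E`. -/
theorem fderiv_eq_zero_of_isSingularPoint {n : ℕ} [n.AtLeastTwo] {ε : ℝ} [Fact (0 < ε)]
    {f g : MvPolynomial (Fin n) ℂ} {p : linkComplement f g ε}
    (hp : IsSingularPoint (𝓡 (2 * n - 1)) ((𝓡 1).prod (𝓡 1)) (milnorProductMap f g ε) p)
    (Y : PartialDiffeomorph ((𝓡 1).prod (𝓡 1)) 𝓘(ℝ, ℝ × ℝ) (Circle × Circle) (ℝ × ℝ) ∞)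
    (hY : milnorProductMap f g ε p ∈ Y.source) {L G : Cn n → ℂ} (hLa : AnalyticAt ℂ L p.1.val)
    (hGa : AnalyticAt ℂ G p.1.val)
    (hYT : ∀ᶠ q in 𝓝 p, milnorProductMap f g ε q ∈ Y.source ∧ Y (milnorProductMap f g ε q) =
      ((L q.1.val).im - (L p.1.val).im, (G q.1.val).im - (G p.1.val).im))
    {E : Cn n} (hEL : fderiv ℂ L p.1.val E = 1) (hEG : fderiv ℂ G p.1.val E = 0)
    (hpos : 0 < (inner ℂ p.1.val E).re)
    (hcE : ∀ c : ℂ, (inner ℂ p.1.val (c • E)).re = c.re * (inner ℂ p.1.val E).re) :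
    fderiv ℂ G p.1.val = 0 := by
  by_contra hne
  obtain ⟨v, hv⟩ : ∃ v, (fderiv ℂ G p.1.val v).im ≠ 0 := by
    by_contra! h
    refine hne (ContinuousLinearMap.ext fun v => Complex.ext ?_ (h v))
    have := h (Complex.I • v)
    rw [map_smul, smul_eq_mul, Complex.I_mul_im] at this
    exact this
  have hT : HasFDerivAt (fun z => ((L z).im - (L p.1.val).im, (G z).im - (G p.1.val).im))
      ((Complex.imCLM.comp ((fderiv ℂ L p.1.val).restrictScalars ℝ)).prod
        (Complex.imCLM.comp ((fderiv ℂ G p.1.val).restrictScalars ℝ))) p.1.val :=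
    ((Complex.imCLM.hasFDerivAt.comp _
      (hLa.differentiableAt.hasFDerivAt.restrictScalars ℝ)).sub_const _).prodMk
    ((Complex.imCLM.hasFDerivAt.comp _
      (hGa.differentiableAt.hasFDerivAt.restrictScalars ℝ)).sub_const _)
  refine not_surjective_of_isSingularPoint hp Y hY hT hYT fun y => ?_
  -- a real multiple of the Euler field makes `v` tangent to the sphere
  obtain ⟨v', h1, h2⟩ : ∃ v', (inner ℂ p.1.val v').re = 0 ∧
      (fderiv ℂ G p.1.val v').im ≠ 0 := by
    let t : ℝ := (inner ℂ p.1.val v).re / (inner ℂ p.1.val E).re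
    refine ⟨v - (t : ℂ) • E, ?_, ?_⟩
    · rw [inner_sub_right, Complex.sub_re, hcE, Complex.ofReal_re, div_mul_cancel₀ _ hpos.ne',
        sub_self]
    · rw [map_sub, map_smul, hEG, smul_zero, sub_zero]
      exact hv
  let a : ℝ := y.2 / (fderiv ℂ G p.1.val v').im
  let b : ℝ := y.1 - a * (fderiv ℂ L p.1.val v').im
  refine ⟨(a : ℂ) • v' + ((b : ℂ) * Complex.I) • E, ?_, ?_⟩
  · rw [inner_add_right, Complex.add_re, hcE, inner_smul_right, Complex.re_ofReal_mul, h1]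
    simp
  · refine Prod.ext ?_ ?_
    · change (fderiv ℂ L p.1.val _).im = y.1
      rw [map_add, map_smul, map_smul, hEL, Complex.add_im, smul_eq_mul, Complex.im_ofReal_mul]
      simp [b]
    · change (fderiv ℂ G p.1.val _).im = y.2
      rw [map_add, map_smul, map_smul, hEG, Complex.add_im, smul_eq_mul, Complex.im_ofReal_mul]
      simp [a, h2]

theorem theorem3p7 {n : ℕ} [n.AtLeastTwo] (ε : ℝ) [Fact (0 < ε)]
    (f g : MvPolynomial (Fin n) ℂ) (wf wg : Fin n → ℚ)
    (hf : HasWeights f wf) (hg : HasWeights g wg)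
    (s : ℚ) (hs : 0 < s) (hw : ∀ j, wg j = s * wf j)
    (p : linkComplement f g ε)
    (hp : IsSingularPoint (𝓡 (2 * n - 1)) ((𝓡 1).prod (𝓡 1)) (milnorProductMap f g ε) p)
    (logf logg : Cn n → ℂ)
    (hlogf : IsLogBranchAt f logf p.1.val) (hlogg : IsLogBranchAt g logg p.1.val) :
    Module.finrank ℝ
        (realOrthogonal p.1.val (Complex.I • complexGrad logf p.1.val)) = 2 * n - 2 ∧
    ∀ (r : Module.Basis (Fin (2 * n - 2)) ℝ
        (realOrthogonal p.1.val (Complex.I • complexGrad logf p.1.val)))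
      (V : Matrix (Fin n) (Fin (2 * n - 2)) ℂ),
      (∀ j a, V j a = (r a : Cn n) j) →
      (IsFoldPoint (𝓡 (2 * n - 1)) ((𝓡 1).prod (𝓡 1)) (milnorProductMap f g ε) p ↔
        ((V.transpose *
          complexHess (fun z => -Complex.I * (logg z - (s : ℂ) * logf z)) p.1.val *
            V).map Complex.re).det ≠ 0) := by
  have hn : 2 ≤ n := Nat.AtLeastTwo.prop
  have hp0 := val_ne_zero p
  have hflowf : ∀ᶠ x : ℂ × Cn n in 𝓝 (0, p.1.val),
      logf (weightedFlow wf x.1 x.2) = logf x.2 + 1 * x.1 :=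
    hlogf.apply_weightedFlow fun c z => by rw [one_mul]; exact hf.polyFun_weightedFlow c z
  have hflowg : ∀ᶠ x : ℂ × Cn n in 𝓝 (0, p.1.val),
      logg (weightedFlow wf x.1 x.2) = logg x.2 + s * x.1 :=
    hlogg.apply_weightedFlow fun c z => by
      rw [← weightedFlow_mul hs.ne' hw]; exact hg.polyFun_weightedFlow _ z
  set G : Cn n → ℂ := fun z => logg z - (s : ℂ) * logf z
  have hGa : AnalyticAt ℂ G p.1.val := hlogg.1.sub (analyticAt_const.mul hlogf.1)
  have hflowG : ∀ᶠ x : ℂ × Cn n in 𝓝 (0, p.1.val), G (weightedFlow wf x.1 x.2) = G x.2 := by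
    filter_upwards [hflowf, hflowg] with x h1 h2
    simp only [G, h1, h2]
    ring
  have hEf : fderiv ℂ logf p.1.val (weightedEuler wf p.1.val) = 1 :=
    fderiv_weightedEuler hlogf.1.differentiableAt hflowf
  have hEG : fderiv ℂ G p.1.val (weightedEuler wf p.1.val) = 0 :=
    fderiv_weightedEuler hGa.differentiableAt (hflowG.mono fun x hx => by simp [hx])
  obtain ⟨hpos, him⟩ := re_inner_weightedEuler_pos hf.1 hp0
  set E := weightedEuler wf p.1.val
  have hcE : ∀ c : ℂ, (inner ℂ p.1.val (c • E)).re = c.re * (inner ℂ p.1.val E).re := by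
    intro c
    rw [inner_smul_right, Complex.mul_re, him, mul_zero, sub_zero]
  obtain ⟨Y, hY1, hY2, hYT⟩ := exists_milnorProductMap_coordinates s p hlogf hlogg
  have hdG : fderiv ℂ G p.1.val = 0 :=
    fderiv_eq_zero_of_isSingularPoint hp Y hY1 hlogf.1 hGa hYT hEf hEG hpos hcE
  refine ⟨finrank_realOrthogonal fun y => ?_, ?_⟩
  · let t : ℝ := y.1 / (inner ℂ p.1.val E).re
    refine ⟨((t : ℂ) + (y.2 : ℂ) * Complex.I) • E, ?_, ?_⟩
    · rw [hcE]
      simp [t, hpos.ne']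
    · rw [inner_I_smul_complexGrad, map_smul, hEf]
      simp
  intro r V hVr
  -- the slice `p + Λ W`, parametrized by the coordinates in the basis `r`
  let W := EuclideanSpace ℝ (Fin (2 * n - 2))
  have hWdim : Module.finrank ℝ W = 2 * n - 2 := finrank_euclideanSpace_fin
  let K := realOrthogonal p.1.val (Complex.I • complexGrad logf p.1.val)
  let ρ : W ≃ₗ[ℝ] K := (EuclideanSpace.equiv (Fin (2 * n - 2)) ℝ).toLinearEquiv.trans
    r.equivFun.symm
  let Λ : W →L[ℝ] Cn n := LinearMap.toContinuousLinearMap (K.subtype.comp ρ.toLinearMap)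
  have hΛi : Function.Injective Λ := Subtype.val_injective.comp ρ.injective
  have hΛK : ∀ u, (inner ℂ p.1.val (Λ u)).re = 0 ∧ (fderiv ℂ logf p.1.val (Λ u)).im = 0 := by
    intro u
    have h1 : Λ u ∈ K := (ρ u).2
    refine ⟨h1.1, ?_⟩
    rw [← inner_I_smul_complexGrad]
    exact h1.2
  have hΛs : ∀ i, Λ (EuclideanSpace.single i 1) = (r i : Cn n) := by
    intro i
    have h1 : ρ (EuclideanSpace.single i 1) = r i := by
      change r.equivFun.symm (Pi.single i 1) = r i
      rw [Module.Basis.equivFun_symm_apply]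
      simp [Pi.single_apply]
    exact congrArg Subtype.val h1
  set h : Cn n → ℂ := fun z => -Complex.I * (logg z - (s : ℂ) * logf z)
  have hha : AnalyticAt ℂ h p.1.val := analyticAt_const.mul hGa
  have hhre : ∀ z, (h z).re = (G z).im := by
    intro z
    simp [h, G]
  have hdh : fderiv ℂ h p.1.val = 0 := by
    have h1 := (hGa.differentiableAt.hasFDerivAt.const_mul (-Complex.I)).fderiv
    rw [hdG] at h1
    exact h1.trans (ContinuousLinearMap.ext fun v => mul_zero (-Complex.I))
  -- `Φ` has the form `(t, u) ↦ (t, Q u)` in the coordinates `X` and `Y` below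
  let Q : W → ℝ := fun u => (h (p.1.val + Λ u)).re - (h p.1.val).re
  have hQa : AnalyticAt ℝ Q 0 := by
    have h0 : AnalyticAt ℝ h (p.1.val + Λ 0) := by
      rw [map_zero, add_zero]; exact hha.restrictScalars
    have h2 : AnalyticAt ℝ (fun u => p.1.val + Λ u) 0 := analyticAt_const.add (Λ.analyticAt 0)
    exact ((Complex.reCLM.analyticAt _).comp
      (AnalyticAt.fun_comp (f := fun u => p.1.val + Λ u) h0 h2)).sub analyticAt_const
  have hQ0 : Q 0 = 0 := by simp [Q]
  have hQ1 : fderiv ℝ Q 0 = 0 := by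
    have h1 : DifferentiableAt ℂ h (p.1.val + Λ 0) := by
      rw [map_zero, add_zero]; exact hha.differentiableAt
    rw [(hasFDerivAt_re_comp_affine h1 (h p.1.val).re).fderiv, map_zero, add_zero, hdh]
    ext u
    simp
  obtain ⟨F, hFa, hF0, hFker, hFz⟩ := exists_slice_coordinates hf.1 hp0 hlogf.1
    (by simpa only [one_mul] using hflowf) hflowG hΛi hΛK hWdim
  have hval : Filter.Tendsto (fun q : linkComplement f g ε => q.1.val) (𝓝 p) (𝓝 p.1.val) :=
    (CSphere.continuous_val.comp continuous_subtype_val).tendsto p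
  obtain ⟨X, hX1, hX2, hX3⟩ := exists_partialDiffeomorph_linkComplement
    (by rw [Module.finrank_prod, Module.finrank_self, hWdim]; omega) p hFa hFker
    (hYT.and (hval.eventually hFz))
  have hXp : X p = 0 := by rw [hX3 p hX1, hF0]
  have hXY : ∀ q ∈ X.source, milnorProductMap f g ε q ∈ Y.source ∧
      Y (milnorProductMap f g ε q) = ((X q).1, Q (X q).2) := by
    intro q hq
    obtain ⟨⟨h1, h2⟩, h3, h4⟩ := hX2 hq
    refine ⟨h1, h2.trans ?_⟩
    rw [hX3 q hq]
    refine Prod.ext h3.symm ?_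
    simp only [Q, hhre]
    rw [← h4]
  rw [det_ne_zero_iff_forall_apply_eq_zero (fderiv ℝ (fderiv ℝ Q) 0)]
  · exact ⟨fun hfold u hu => nondegenerate_of_isFoldPoint hQa hQ0 hQ1 X Y hX1 hY1 hXp hY2 hXY
      hfold hu, fun hnd => isFoldPoint_of_nondegenerate (by rw [hWdim]; omega) hQa hQ0 hQ1 X Y
      hX1 hY1 hXp hY2 hXY hnd⟩
  · intro i j
    rw [fderiv_fderiv_re_comp_affine hha, fderiv_fderiv_eq_sum_complexHess hha, hΛs, hΛs,
      Matrix.map_apply, Finset.sum_comm]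
    simp only [Matrix.mul_apply, Matrix.transpose_apply, hVr, Finset.sum_mul]
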